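/- **Setting.** Let $N\in\mathbb N$. Let $C(S^{N-1}_{\mathbb R,+})$ be the universal unital $C^*$-algebra generated by self-adjoint elements $x_1,\ldots,x_N$ subject to $\sum_ix_i^2=1$. A (closed, noncommutative) subspace $S\subset S^{N-1}_{\mathbb R,+}$ is a closed two-sided ideal of this algebra, with quotient $C(S)$; inclusion $S\subset T$ means reverse inclusion of the ideals, and $S\cap T$ corresponds to the closed two-sided ideal generated by the two ideals. Imposing relations on the coordinates means passing to the closed two-sided ideal generated by them. *Main spheres.* $S^{N-1}_{\mathbb R}$ is the usual unit sphere of $\mathbb R^N$, embedded via the morphism $C(S^{N-1}_{\mathbb R,+})\to C(S^{N-1}_{\mathbb R})$ sending the $x_i$ to the coordinate functions. The half-liberated sphere $S^{N-1}_{\mathbb R,*}$ is obtained by imposing $x_ix_jx_k=x_kx_jx_i$ for all $i,j,k$. The twisted sphere $\bar S^{N-1}_{\mathbb R}$ is obtained by imposing $x_ix_j=-x_jx_i$ for $i\neq j$. The twisted half-liberated sphere $\bar S^{N-1}_{\mathbb R,*}$ is obtained by imposing $x_ix_jx_k=-x_kx_jx_i$ for $i,j,k$ distinct and $x_ix_jx_k=x_kx_jx_i$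 otherwise. For any of these spheres $\dot S^{N-1}_{\mathbb R,\times}$ (twisted or not), $\dot S^{N-1,d-1}_{\mathbb R,\times}\subset\dot S^{N-1}_{\mathbb R,\times}$ is obtained by imposing $x_{i_0}\cdots x_{i_d}=0$ for $i_0,\ldots,i_d$ distinct. *Relations.* For $\sigma\in S_k$, let $\mathcal R_\sigma$ be the relations $x_{i_1}\cdots x_{i_k}=x_{i_{\sigma(1)}}\cdots x_{i_{\sigma(k)}}$, for all $i_1,\ldots,i_k\in\{1,\ldots,N\}$, and let $\bar{\mathcal R}_\sigma$ be the relations $x_{i_1}\cdots x_{i_k}=\varepsilon(\pi_{i,\sigma})\,x_{i_{\sigma(1)}}\cdots x_{i_{\sigma(k)}}$, for all $i_1,\ldots,i_k$. Here $\pi_{i,\sigma}=\ker\binom{i_1\ \ldots\ i_k}{i_{\sigma(1)}\ldots i_{\sigma(k)}}$ is the partition of the $k$ upper and $k$ lower legs in which two legs are in the same block when they carry the same index, and $\varepsilon(\pi)=(-1)^c$, where $c$ is the number of switches of neighboring legs in the same row, belonging to different blocks, needed to make $\pi$ noncrossing (for partitions with all blocks of even size the parity of $c$ is well defined). For sets $E,F$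 of permutations of variable size $k\in\mathbb N$, the untwisted monomial sphere $S^{N-1}_{\mathbb R,E}$ is obtained from $S^{N-1}_{\mathbb R,+}$ by imposing $\mathcal R_\sigma$ for all $\sigma\in E$, the twisted monomial sphere $\bar S^{N-1}_{\mathbb R,F}$ by imposing $\bar{\mathcal R}_\sigma$ for all $\sigma\in F$, and the polygonal sphere is $S^{N-1}_{\mathbb R,E,F}=S^{N-1}_{\mathbb R,E}\cap\bar S^{N-1}_{\mathbb R,F}$. **Theorem 8.6.** For any $N\in\mathbb N$ the following hold: 1. $S^{N-1}_{\mathbb R}\subset S^{N-1}_{\mathbb R,*}\subset S^{N-1}_{\mathbb R,+}$, and the set of untwisted monomial spheres is $\{S^{N-1}_{\mathbb R},S^{N-1}_{\mathbb R,*},S^{N-1}_{\mathbb R,+}\}$. 2. $\bar S^{N-1}_{\mathbb R}\subset\bar S^{N-1}_{\mathbb R,*}\subset S^{N-1}_{\mathbb R,+}$, and the set of twisted monomial spheres is $\{\bar S^{N-1}_{\mathbb R},\bar S^{N-1}_{\mathbb R,*},S^{N-1}_{\mathbb R,+}\}$. 3. The set of polygonal spheres consists of the entries of the table $$\begin{matrix}S^{N-1}_{\mathbb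 R}&S^{N-1}_{\mathbb R,*}&S^{N-1}_{\mathbb R,+}\\ S^{N-1,1}_{\mathbb R}&S^{N-1,1}_{\mathbb R,*}&\bar S^{N-1}_{\mathbb R,*}\\ S^{N-1,0}_{\mathbb R}&\bar S^{N-1,1}_{\mathbb R}&\bar S^{N-1}_{\mathbb R}\end{matrix}$$ in which each entry is the intersection of the first entry in its column with the last entry in its row. For $N\geq3$ these nine spheres are pairwise distinct. -/

import Mathlib

open scoped ENNReal

namespace QSphere

noncomputable section

/-! ### The free sphere -/

/-- An `N`-tuple of self-adjoint elements, with squares summing up to `1`, in some nonzero unital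
C⋆-algebra, that is, a nonzero C⋆-algebra together with a solution of the relations
`xᵢ = xᵢ*`, `∑ xᵢ² = 1`. A C⋆-algebra generated by finitely many elements has at most continuum
many elements, so, up to isomorphism, no generated C⋆-algebra is lost by asking for `A : Type`. -/
structure SphereTuple (N : ℕ) : Type 1 where
  /-- the C⋆-algebra -/
  A : Type
  [cstar : CStarAlgebra A]
  [nontrivial : Nontrivial A]
  /-- the elements -/
  x : Fin N → A
  star_x : ∀ i, star (x i) = x i
  sum_sq : ∑ i, x i * x i = 1

attribute [instance] SphereTuple.cstar SphereTuple.nontrivial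

theorem SphereTuple.norm_le_one {N : ℕ} (t : SphereTuple N) (i : Fin N) : ‖t.x i‖ ≤ 1 := by
  let _ := CStarAlgebra.spectralOrder t.A
  have := CStarAlgebra.spectralOrderedRing t.A
  have hnn : ∀ j, 0 ≤ t.x j * t.x j := fun j => by
    have h := star_mul_self_nonneg (t.x j)
    rwa [t.star_x] at h
  have hle : t.x i * t.x i ≤ 1 := by
    rw [← t.sum_sq]
    exact Finset.single_le_sum (f := fun j => t.x j * t.x j) (fun j _ => hnn j)
      (Finset.mem_univ i)
  have h1 : ‖t.x i * t.x i‖ ≤ 1 := (CStarAlgebra.norm_le_one_iff_of_nonneg _ (hnn i)).2 hle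
  have h2 : ‖star (t.x i) * t.x i‖ = ‖t.x i‖ * ‖t.x i‖ := CStarRing.norm_star_mul_self
  rw [t.star_x] at h2
  nlinarith [norm_nonneg (t.x i)]

/-- The bounded families `(a_t)`, with `a_t` in the C⋆-algebra of `t`, for `t` ranging over all the
solutions of the relations defining the free sphere. -/
abbrev Ambient (N : ℕ) : Type 1 := lp (fun t : SphereTuple N => t.A) ∞

instance (N : ℕ) : CStarAlgebra (Ambient N) where

/-- The family of all `i`-th coordinates. -/
def ambientCoord (N : ℕ) (i : Fin N) : Ambient N :=
  ⟨fun t => t.x i, memℓp_infty ⟨1, by rintro _ ⟨t, rfl⟩; exact t.norm_le_one i⟩⟩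

/-- The closed `⋆`-subalgebra generated by the coordinates. -/
def freeSubalgebra (N : ℕ) : StarSubalgebra ℂ (Ambient N) :=
  (StarAlgebra.adjoin ℂ (Set.range (ambientCoord N))).topologicalClosure

/-- The algebra `C(S^{N-1}_{ℝ,+})`: the universal C⋆-algebra generated by self-adjoint elements
`x₁, …, x_N` with `∑ xᵢ² = 1`. The norm of a polynomial in the coordinates is the supremum of the
norms of its values in all C⋆-algebras; see `lift` and `hom_ext` for the universal property. -/
def FreeAlg (N : ℕ) : Type 1 := freeSubalgebra N

instance (N : ℕ) : IsClosed (freeSubalgebra N : Set (Ambient N)) :=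
  StarSubalgebra.isClosed_topologicalClosure _

instance (N : ℕ) : CStarAlgebra (FreeAlg N) :=
  inferInstanceAs (CStarAlgebra (freeSubalgebra N))

/-- The standard coordinates of the free sphere. -/
def coord {N : ℕ} (i : Fin N) : FreeAlg N :=
  ⟨ambientCoord N i, StarSubalgebra.le_topologicalClosure _
    (StarAlgebra.subset_adjoin ℂ _ ⟨i, rfl⟩)⟩

/-- Evaluation at a given solution of the relations. -/
def evalHom {N : ℕ} (t : SphereTuple N) : FreeAlg N →⋆ₐ[ℂ] t.A where
  toFun a := a.1.1 t
  map_one' := rfl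
  map_mul' _ _ := rfl
  map_zero' := rfl
  map_add' _ _ := rfl
  commutes' _ := rfl
  map_star' _ := rfl

theorem evalHom_coord {N : ℕ} (t : SphereTuple N) (i : Fin N) : evalHom t (coord i) = t.x i := rfl

/-- The evaluations separate the elements of `C(S^{N-1}_{ℝ,+})`. -/
theorem ext_evalHom {N : ℕ} {a b : FreeAlg N} (h : ∀ t, evalHom t a = evalHom t b) : a = b :=
  Subtype.ext (lp.ext (funext h))

theorem star_coord {N : ℕ} (i : Fin N) : star (coord i) = coord i := by
  refine ext_evalHom fun t => ?_
  rw [map_star, evalHom_coord, t.star_x]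

theorem sum_coord_sq (N : ℕ) : ∑ i : Fin N, coord i * coord i = 1 := by
  refine ext_evalHom fun t => ?_
  simp only [map_sum, map_mul, map_one, evalHom_coord, t.sum_sq]

/-- The existence part of the universal property of `C(S^{N-1}_{ℝ,+})`. -/
def lift {N : ℕ} {A : Type} [CStarAlgebra A] (x : Fin N → A) (hs : ∀ i, star (x i) = x i)
    (h1 : ∑ i, x i * x i = 1) : FreeAlg N →⋆ₐ[ℂ] A :=
  open Classical in
  if h : Nontrivial A then
    evalHom { A := A, x := x, star_x := hs, sum_sq := h1 }
  else
    haveI : Subsingleton A := not_nontrivial_iff_subsingleton.1 h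
    { toFun := fun _ => 0
      map_one' := Subsingleton.elim _ _
      map_mul' := fun _ _ => Subsingleton.elim _ _
      map_zero' := Subsingleton.elim _ _
      map_add' := fun _ _ => Subsingleton.elim _ _
      commutes' := fun _ => Subsingleton.elim _ _
      map_star' := fun _ => Subsingleton.elim _ _ }

theorem lift_coord {N : ℕ} {A : Type} [CStarAlgebra A] (x : Fin N → A)
    (hs : ∀ i, star (x i) = x i) (h1 : ∑ i, x i * x i = 1) (i : Fin N) :
    lift x hs h1 (coord i) = x i := by
  unfold lift
  split_ifs with h
  · rfl
  · have : Subsingleton A := not_nontrivial_iff_subsingleton.1 h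
    exact Subsingleton.elim _ _

theorem continuous_hom {N : ℕ} {A : Type*} [CStarAlgebra A] (f : FreeAlg N →⋆ₐ[ℂ] A) :
    Continuous f :=
  AddMonoidHomClass.continuous_of_bound f 1 fun a => by
    simpa only [one_mul] using NonUnitalStarAlgHom.norm_apply_le f a

/-- The uniqueness part of the universal property of `C(S^{N-1}_{ℝ,+})`. -/
theorem hom_ext {N : ℕ} {A : Type*} [CStarAlgebra A] {f g : FreeAlg N →⋆ₐ[ℂ] A}
    (h : ∀ i, f (coord i) = g (coord i)) : f = g := by
  refine StarAlgHom.ext_topologicalClosure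
    (S := StarAlgebra.adjoin ℂ (Set.range (ambientCoord N)))
    (continuous_hom f) (continuous_hom g) ?_
  refine StarAlgHom.ext_adjoin ?_
  rintro ⟨_, hx⟩ ⟨i, rfl⟩
  exact h i

/-! ### Closed subspaces of the free sphere -/

/-- A closed noncommutative subspace `S ⊂ S^{N-1}_{ℝ,+}`, given by a closed two-sided ideal: the
kernel of the quotient map `C(S^{N-1}_{ℝ,+}) → C(S)`. -/
@[ext]
structure Subspace (N : ℕ) : Type 1 where
  /-- the ideal of elements vanishing on `S` -/
  ideal : TwoSidedIdeal (FreeAlg N)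
  isClosed : IsClosed (ideal : Set (FreeAlg N))

/-- Inclusion of subspaces: `S ⊂ T` when `C(S)` is a quotient of `C(T)`. -/
instance (N : ℕ) : LE (Subspace N) := ⟨fun S T => T.ideal ≤ S.ideal⟩

/-- The subspace obtained by imposing the relations `r = 0`, for `r ∈ R`, that is, the one
corresponding to the closed two-sided ideal generated by `R`. -/
def ofRelations {N : ℕ} (R : Set (FreeAlg N)) : Subspace N where
  ideal := sInf {I | IsClosed (I : Set (FreeAlg N)) ∧ R ⊆ I}
  isClosed := by
    have h : ((sInf {I : TwoSidedIdeal (FreeAlg N) | IsClosed (I : Set (FreeAlg N)) ∧ R ⊆ I} :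
        TwoSidedIdeal (FreeAlg N)) : Set (FreeAlg N)) =
        ⋂ I ∈ {I : TwoSidedIdeal (FreeAlg N) | IsClosed (I : Set (FreeAlg N)) ∧ R ⊆ I},
          (I : Set (FreeAlg N)) := by
      ext x
      simp only [SetLike.mem_coe, TwoSidedIdeal.mem_sInf, Set.mem_iInter]
    rw [h]
    exact isClosed_biInter fun I hI => hI.1

/-- The intersection of two subspaces, obtained by merging their relations. -/
def inter {N : ℕ} (S T : Subspace N) : Subspace N :=
  ofRelations ((S.ideal : Set (FreeAlg N)) ∪ (T.ideal : Set (FreeAlg N)))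

/-- The subspace `X ⊂ S^{N-1}_{ℝ,+}` that is the image of a morphism of C⋆-algebras
`C(S^{N-1}_{ℝ,+}) → A`. -/
def ofHom {N : ℕ} {A : Type*} [CStarAlgebra A] (f : FreeAlg N →⋆ₐ[ℂ] A) : Subspace N where
  ideal := TwoSidedIdeal.ker f
  isClosed := by
    have h : ((TwoSidedIdeal.ker f : TwoSidedIdeal (FreeAlg N)) : Set (FreeAlg N)) =
        f ⁻¹' {0} := by
      ext x
      simp [TwoSidedIdeal.mem_ker]
    rw [h]
    exact isClosed_singleton.preimage (continuous_hom f)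

/-! ### The five main spheres -/

/-- The free sphere `S^{N-1}_{ℝ,+}`, as a subspace of itself. -/
def freeSphere (N : ℕ) : Subspace N := ofRelations ∅

/-- The unit sphere of the Euclidean space `ℝ^N`. -/
abbrev UnitSphere (N : ℕ) : Type := Metric.sphere (0 : EuclideanSpace ℝ (Fin N)) 1

/-- The coordinate functions on the unit sphere of `ℝ^N`. -/
def realCoord {N : ℕ} (i : Fin N) : C(UnitSphere N, ℂ) where
  toFun p := ((p : EuclideanSpace ℝ (Fin N)) i : ℂ)
  continuous_toFun := by fun_prop

/-- The quotient map `C(S^{N-1}_{ℝ,+}) → C(S^{N-1}_ℝ)`, sending the standard coordinates to the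
coordinate functions. -/
def toReal (N : ℕ) : FreeAlg N →⋆ₐ[ℂ] C(UnitSphere N, ℂ) :=
  lift realCoord (fun i => by ext p; simp [realCoord]) (by
    ext p
    have hp : ‖(p : EuclideanSpace ℝ (Fin N))‖ = 1 := by simp
    have h : ∑ i, (p : EuclideanSpace ℝ (Fin N)) i * (p : EuclideanSpace ℝ (Fin N)) i = 1 := by
      have h2 := EuclideanSpace.real_norm_sq_eq (p : EuclideanSpace ℝ (Fin N))
      rw [hp] at h2
      simp only [← sq]
      linarith
    simp only [ContinuousMap.coe_sum, Finset.sum_apply, ContinuousMap.mul_apply,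
      ContinuousMap.one_apply, realCoord, ContinuousMap.coe_mk]
    exact_mod_cast h)

/-- The usual sphere `S^{N-1}_ℝ`, as a subspace of the free sphere. -/
def realSphere (N : ℕ) : Subspace N := ofHom (toReal N)

/-- The half-liberated sphere `S^{N-1}_{ℝ,*}`. -/
def halfSphere (N : ℕ) : Subspace N :=
  ofRelations {r | ∃ i j k : Fin N, r = coord i * coord j * coord k - coord k * coord j * coord i}

/-- The twisted sphere: `xᵢxⱼ = -xⱼxᵢ` for `i ≠ j`. -/
def twistedSphere (N : ℕ) : Subspace N :=
  ofRelations {r | ∃ i j : Fin N, i ≠ j ∧ r = coord i * coord j + coord j * coord i}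

/-- The twisted half-liberated sphere: `xᵢxⱼx_k = -x_kxⱼxᵢ` for `i, j, k` distinct, and
`xᵢxⱼx_k = x_kxⱼxᵢ` otherwise. -/
def twistedHalfSphere (N : ℕ) : Subspace N :=
  ofRelations
    ({r | ∃ i j k : Fin N, (i ≠ j ∧ j ≠ k ∧ i ≠ k) ∧
        r = coord i * coord j * coord k + coord k * coord j * coord i} ∪
     {r | ∃ i j k : Fin N, ¬ (i ≠ j ∧ j ≠ k ∧ i ≠ k) ∧
        r = coord i * coord j * coord k - coord k * coord j * coord i})

/-! ### The signature of a partition -/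

section Signature

variable {k l : ℕ}

/-- The position of a leg of a partition in `P(k,l)`, having `k` upper and `l` lower legs, counted
clockwise from top left. -/
def clockwise : Fin k ⊕ Fin l → ℕ
  | Sum.inl p => p
  | Sum.inr q => k + q.rev

/-- A partition in `P(k,l)` is noncrossing when no two distinct blocks cross. -/
def IsNoncrossing (π : Setoid (Fin k ⊕ Fin l)) : Prop :=
  ∀ a b c d : Fin k ⊕ Fin l, clockwise a < clockwise b → clockwise b < clockwise c →
    clockwise c < clockwise d → π.r a c → π.r b d → π.r a b

/-- `SwitchesTo c π ρ`: the partition `ρ` is obtained from `π` by performing `c` switches of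
neighboring legs, both in the upper row or both in the lower row, that belong to different
blocks. -/
inductive SwitchesTo : ℕ → Setoid (Fin k ⊕ Fin l) → Setoid (Fin k ⊕ Fin l) → Prop
  | refl (π : Setoid (Fin k ⊕ Fin l)) : SwitchesTo 0 π π
  | upper {c : ℕ} {π ρ : Setoid (Fin k ⊕ Fin l)} (p q : Fin k) (hpq : (p : ℕ) + 1 = q)
      (hblock : ¬ π.r (Sum.inl p) (Sum.inl q))
      (h : SwitchesTo c (π.comap (Equiv.swap (Sum.inl p) (Sum.inl q))) ρ) :
      SwitchesTo (c + 1) π ρ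
  | lower {c : ℕ} {π ρ : Setoid (Fin k ⊕ Fin l)} (p q : Fin l) (hpq : (p : ℕ) + 1 = q)
      (hblock : ¬ π.r (Sum.inr p) (Sum.inr q))
      (h : SwitchesTo c (π.comap (Equiv.swap (Sum.inr p) (Sum.inr q))) ρ) :
      SwitchesTo (c + 1) π ρ

open Classical in
/-- The signature `ε(π) = (-1)^c`, where `c` is the number of switches needed to make `π`
noncrossing. For a partition all of whose blocks have even size, the parity of `c` does not depend
on the choice of the switches. -/
def signature (π : Setoid (Fin k ⊕ Fin l)) : ℤ :=
  if ∃ c ρ, Even c ∧ SwitchesTo c π ρ ∧ IsNoncrossing ρ then 1 else -1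

/-- The kernel of a multi-index with upper row `i` and lower row `j`: two legs are in the same block
when they carry the same index. -/
def kernel {N : ℕ} (i : Fin k → Fin N) (j : Fin l → Fin N) : Setoid (Fin k ⊕ Fin l) :=
  Setoid.ker (Sum.elim i j)

end Signature

/-! ### Untwisted, twisted and polygonal spheres -/

/-- The monomial `x_{i₁} ⋯ x_{i_k}`. -/
def monomial {N k : ℕ} (i : Fin k → Fin N) : FreeAlg N := (List.ofFn fun p => coord (i p)).prod

/-- The untwisted relations associated to `σ ∈ S_k`, for all the multi-indices `i`. -/
def untwistedRel (N : ℕ) {k : ℕ} (σ : Equiv.Perm (Fin k)) : Set (FreeAlg N) :=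
  {r | ∃ i : Fin k → Fin N, r = monomial i - monomial (i ∘ σ)}

/-- The twisted relations associated to `σ ∈ S_k`, for all the multi-indices `i`. -/
def twistedRel (N : ℕ) {k : ℕ} (σ : Equiv.Perm (Fin k)) : Set (FreeAlg N) :=
  {r | ∃ i : Fin k → Fin N, r = monomial i - signature (kernel i (i ∘ σ)) • monomial (i ∘ σ)}

/-- Permutations of variable size. -/
abbrev Permutation : Type := Σ k : ℕ, Equiv.Perm (Fin k)

/-- The untwisted monomial sphere associated to a set of permutations. -/
def untwistedMonomial (N : ℕ) (E : Set Permutation) : Subspace N :=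
  ofRelations (⋃ σ ∈ E, untwistedRel N σ.2)

/-- The twisted monomial sphere associated to a set of permutations. -/
def twistedMonomial (N : ℕ) (F : Set Permutation) : Subspace N :=
  ofRelations (⋃ σ ∈ F, twistedRel N σ.2)

/-- The polygonal sphere associated to two sets of permutations. -/
def polygonal (N : ℕ) (E F : Set Permutation) : Subspace N :=
  inter (untwistedMonomial N E) (twistedMonomial N F)

/-! ### The nine main spheres -/

/-- The subspace of `S` obtained by assuming that `x_{i₀} ⋯ x_{i_d} = 0`, for `i₀, …, i_d`
distinct. -/
def vanishing {N : ℕ} (d : ℕ) (S : Subspace N) : Subspace N :=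
  inter S (ofRelations {r | ∃ i : Fin (d + 1) → Fin N, Function.Injective i ∧ r = monomial i})

/-- The untwisted spheres, from the smallest to the largest. -/
def untwistedMain (N : ℕ) : Fin 3 → Subspace N := ![realSphere N, halfSphere N, freeSphere N]

/-- The twisted spheres, from the smallest to the largest. -/
def twistedMain (N : ℕ) : Fin 3 → Subspace N :=
  ![twistedSphere N, twistedHalfSphere N, freeSphere N]

/-- The nine main spheres: `nineMain N b a` is the entry in the row of the `b`-th twisted sphere and
the column of the `a`-th untwisted sphere. -/
def nineMain (N : ℕ) : Fin 3 → Fin 3 → Subspace N :=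
  ![![vanishing 1 (realSphere N), vanishing 2 (twistedSphere N), twistedSphere N],
    ![vanishing 2 (realSphere N), vanishing 2 (halfSphere N), twistedHalfSphere N],
    ![realSphere N, halfSphere N, freeSphere N]]

end

end QSphere

/-!
The relations of a permutation `σ` hold for every multi-index, so they can be multiplied, inverted,
shifted, and, by `∑ xᵢ² = 1`, shortened: the positions can be exchanged according to a group of
permutations of `ℕ`, and the relations `σ ≠ 1` generate either half-commutation, when `σ` preserves
the parity of positions, or commutation. Tensoring the coordinates with the anticommuting generators
of a Clifford algebra turns the twisted relations into the untwisted ones, since the words in these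
generators are permuted with the signature of the kernel as sign. Hence the twisted classification
follows from the untwisted one.

A quotient of the free sphere whose coordinates commute is a quotient of the continuous functions on
the usual sphere, because every character is the evaluation at a point. In the table, a family
satisfying both an untwisted and a twisted relation has vanishing products of distinct members.
Conversely, `1, 2, 3` commuting or anticommuting symmetries tell the entries apart.
-/

namespace QSphere

open Equiv Filter
open scoped TensorProduct commutatorElement

section Words

variable {ι A : Type*}

/-- The product of the entries of `x` along a word. -/
def word [Monoid A] (x : ι → A) (w : List ι) : A := (w.map x).prod

section Monoid

variable [Monoid A] (x : ι → A)

@[simp] theorem word_nil : word x [] = 1 := rfl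

@[simp] theorem word_cons (i : ι) (w : List ι) : word x (i :: w) = x i * word x w := by
  simp [word]

@[simp] theorem word_append (v w : List ι) : word x (v ++ w) = word x v * word x w := by
  simp [word]

/-- The finitely supported permutations of the positions that do not change the value of any
sufficiently long word. -/
def positionSymmetries : Subgroup (Perm ℕ) where
  carrier := {σ | ∀ᶠ n in atTop, σ n = n ∧
    ∀ i : ℕ → ι, word x ((List.range n).map i) = word x ((List.range n).map (i ∘ σ))}
  one_mem' := .of_forall fun _ => ⟨rfl, fun _ => rfl⟩
  mul_mem' {σ τ} hσ hτ := by
    filter_upwards [hσ, hτ] with n hσ hτ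
    exact ⟨by rw [Perm.mul_apply, hτ.1, hσ.1], fun i => (hσ.2 i).trans (hτ.2 (i ∘ σ))⟩
  inv_mem' {σ} hσ := by
    filter_upwards [hσ] with n hσ
    refine ⟨Perm.inv_eq_iff_eq.2 hσ.1.symm, fun i => ?_⟩
    have hcancel : (i ∘ ⇑σ⁻¹) ∘ ⇑σ = i := by ext p; simp
    exact ((hσ.2 (i ∘ ⇑σ⁻¹)).trans (by rw [hcancel])).symm

variable {x}

theorem mem_positionSymmetries {σ : Perm ℕ} : σ ∈ positionSymmetries x ↔ ∀ᶠ n in atTop, σ n = n ∧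
    ∀ i : ℕ → ι, word x ((List.range n).map i) = word x ((List.range n).map (i ∘ σ)) :=
  Iff.rfl

/-- The permutation `σ`, acting on the integers `≥ m`. -/
def shiftPerm (m : ℕ) (σ : Perm ℕ) : Perm ℕ :=
  σ.extendDomain (p := fun p => m ≤ p)
    { toFun := fun p => ⟨m + p, Nat.le_add_right m p⟩
      invFun := fun p => p.1 - m
      left_inv := fun p => by simp
      right_inv := fun p => Subtype.ext (Nat.add_sub_cancel' p.2) }

theorem shiftPerm_add (m : ℕ) (σ : Perm ℕ) (p : ℕ) : shiftPerm m σ (m + p) = m + σ p :=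
  Perm.extendDomain_apply_image σ (p := fun p => m ≤ p) _ p

theorem shiftPerm_of_lt {m p : ℕ} (σ : Perm ℕ) (hp : p < m) : shiftPerm m σ p = p :=
  Perm.extendDomain_apply_not_subtype _ _ (by omega)

theorem shiftPerm_mem_positionSymmetries {σ : Perm ℕ} (hσ : σ ∈ positionSymmetries x) (m : ℕ) :
    shiftPerm m σ ∈ positionSymmetries x := by
  rw [mem_positionSymmetries, ← map_add_atTop_eq_nat m, eventually_map]
  filter_upwards [hσ] with n ⟨hn, hσ⟩
  rw [add_comm n m, shiftPerm_add, hn]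
  refine ⟨rfl, fun i => ?_⟩
  have hlow : (List.range m).map (i ∘ shiftPerm m σ) = (List.range m).map i :=
    List.map_congr_left fun p hp => by
      rw [Function.comp_apply, shiftPerm_of_lt _ (List.mem_range.1 hp)]
  have hhigh : (i ∘ shiftPerm m σ) ∘ (m + ·) = (i ∘ (m + ·)) ∘ σ := by
    ext p
    simp only [Function.comp_apply, shiftPerm_add]
  rw [List.range_add, List.map_append, List.map_append, word_append, word_append, hlow,
    List.map_map, List.map_map, hhigh, hσ]

theorem word_eq_of_mem_positionSymmetries {σ : Perm ℕ} (hσ : σ ∈ positionSymmetries x) :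
    ∀ᶠ n in atTop, ∀ L L' : List ι, L.length = n → L'.length = n →
      (∀ m < n, L'[m]? = L[σ m]?) → word x L = word x L' := by
  filter_upwards [hσ] with n ⟨_, hσ⟩ L L' hL hL' h
  rcases L with _ | ⟨d, T⟩
  · rw [List.eq_nil_of_length_eq_zero (hL'.trans hL.symm)]
  · have h1 : (List.range n).map (fun m => (d :: T)[m]?.getD d) = d :: T := by
      apply List.ext_getElem <;> grind
    have h2 : (List.range n).map ((fun m => (d :: T)[m]?.getD d) ∘ σ) = L' := by
      apply List.ext_getElem <;> grind
    rw [← h1, ← h2]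
    exact hσ _

end Monoid
end Words

theorem commutatorElement_eq_of_overlap {α : Type*} [DecidableEq α] {σ τ : Perm α} {c : α}
    (h : ∀ p, p ≠ c → σ p = p ∨ τ p = p) (hσ : σ c ≠ c) :
    ⁅σ, τ⁆ = swap c (σ c) * swap (τ c) (σ c) := by
  set s := swap c (σ c)
  have hfix : τ (σ c) = σ c := (h (σ c) hσ).resolve_left fun h => hσ (σ.injective h)
  have hdisjoint : Perm.Disjoint (s * σ) τ := fun p => by
    grind [Perm.mul_apply, σ.injective.eq_iff]
  calc ⁅σ, τ⁆ = s * (s * σ * τ * (s * σ)⁻¹) * s * τ⁻¹ := by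
        simp [commutatorElement_def, s, mul_assoc]
    _ = s * (τ * s * τ⁻¹) := by
        rw [hdisjoint.commute.eq, mul_inv_cancel_right]; simp only [mul_assoc]
    _ = s * swap (τ c) (σ c) := by rw [← swap_apply_apply, hfix]

section Words

variable {ι A : Type*} [Ring A] {x : ι → A}

section Cancellation

variable [Fintype ι] (hx : ∑ i, x i * x i = 1)
include hx

theorem mul_eq_mul_of_forall_sq {a b c d : A}
    (h : ∀ i, a * (x i * x i) * b = c * (x i * x i) * d) : a * b = c * d :=
  calc a * b = ∑ i, a * (x i * x i) * b := by rw [← Finset.sum_mul, ← Finset.mul_sum, hx, mul_one]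
    _ = ∑ i, c * (x i * x i) * d := Finset.sum_congr rfl fun i _ => h i
    _ = c * d := by rw [← Finset.sum_mul, ← Finset.mul_sum, hx, mul_one]

theorem eq_of_word_mul_eq {a b : A} (n : ℕ)
    (h : ∀ P : List ι, P.length = n → word x P * a = word x P * b) : a = b := by
  induction n generalizing a b with
  | zero => simpa using h [] rfl
  | succ n ih =>
    have hcancel (i : ι) : x i * a = x i * b := ih fun P hP => by
      simpa [mul_assoc] using h (P ++ [i]) (by simp [hP])
    have := mul_eq_mul_of_forall_sq hx (a := 1) (b := a) (c := 1) (d := b) fun i => by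
      simp only [mul_assoc, hcancel]
    simpa only [one_mul] using this

theorem eq_of_mul_word_eq {a b : A} (n : ℕ)
    (h : ∀ P : List ι, P.length = n → a * word x P = b * word x P) : a = b := by
  induction n generalizing a b with
  | zero => simpa using h [] rfl
  | succ n ih =>
    have hcancel (i : ι) : a * x i = b * x i := ih fun P hP => by
      simpa [mul_assoc] using h (i :: P) (by simp [hP])
    have := mul_eq_mul_of_forall_sq hx (a := a) (b := 1) (c := b) (d := 1) fun i => by
      simp only [← mul_assoc, hcancel]
    simpa only [mul_one] using this

theorem mul_word_mul_eq_of_capped {a b c d : A} {n : ℕ} (m : ℕ)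
    (h : ∀ U : List ι, U.length = n + 2 * m → a * word x U * b = c * word x U * d)
    (U : List ι) (hU : U.length = n) : a * word x U * b = c * word x U * d := by
  induction m generalizing U n with
  | zero => exact h U hU
  | succ m ih =>
    refine mul_eq_mul_of_forall_sq hx fun i => ?_
    simpa [mul_assoc] using
      ih (n := n + 2) (fun V hV => h V (by omega)) (U ++ [i, i]) (by simp [hU])

end Cancellation

/-- Half-commutation of a family. -/
def HalfCommute (x : ι → A) : Prop := ∀ i j k, x i * x j * x k = x k * x j * x i

/-- Commutation of a family. -/
def PairwiseCommute (x : ι → A) : Prop := ∀ i j, x i * x j = x j * x i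

theorem PairwiseCommute.halfCommute (h : PairwiseCommute x) : HalfCommute x := fun i j k => by
  rw [h i j, mul_assoc, h i k, ← mul_assoc, h j k]

theorem HalfCommute.mul_word_mul (h : HalfCommute x) {U : List ι} (hU : Odd U.length) (p q : ι) :
    x p * word x U * x q = x q * word x U * x p := by
  induction U using List.twoStepInduction generalizing p q with
  | nil => simp at hU
  | singleton s => simpa using h p s q
  | cons_cons s t U ih _ =>
    replace hU : Odd U.length := by simpa [parity_simps] using hU
    calc x p * word x (s :: t :: U) * x q = x p * x s * (x t * word x U * x q) := by
          simp [mul_assoc]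
      _ = x p * x s * x q * word x U * x t := by rw [ih hU]; simp only [mul_assoc]
      _ = x q * x s * (x p * word x U * x t) := by rw [h p s q]; simp only [mul_assoc]
      _ = x q * word x (s :: t :: U) * x p := by rw [ih hU]; simp [mul_assoc]

theorem swap_mem_positionSymmetries {a b : ℕ} (hab : a < b)
    (h : ∀ U : List ι, U.length = b - a - 1 → ∀ p q, x p * word x U * x q = x q * word x U * x p) :
    swap a b ∈ positionSymmetries x := by
  filter_upwards [eventually_gt_atTop b] with n hn
  refine ⟨swap_apply_of_ne_of_ne (by omega) (by omega), fun i => ?_⟩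
  have hsplit : List.range n = List.range a ++ a :: List.range' (a + 1) (b - a - 1) ++
      b :: List.range' (b + 1) (n - b - 1) := by
    obtain ⟨u, rfl⟩ : ∃ u, b = a + (u + 1) := ⟨b - a - 1, by omega⟩
    obtain ⟨v, rfl⟩ : ∃ v, n = a + (u + 1) + (v + 1) := ⟨n - (a + (u + 1)) - 1, by omega⟩
    simp only [List.range_eq_range', ← List.range'_append_1, List.range'_succ]
    grind
  have hcongr {l : List ℕ} (ha : a ∉ l) (hb : b ∉ l) : l.map (i ∘ swap a b) = l.map i :=
    List.map_congr_left fun p hp => congrArg i (swap_apply_of_ne_of_ne (by grind) (by grind))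
  simp only [hsplit, List.map_append, List.map_cons, word_append, word_cons, Function.comp_apply,
    swap_apply_left, swap_apply_right]
  rw [hcongr (by grind) (by grind), hcongr (by grind) (by grind), hcongr (by grind) (by grind)]
  simpa only [mul_assoc] using congrArg
    (word x ((List.range a).map i) * · * word x ((List.range' (b + 1) (n - b - 1)).map i))
    (h ((List.range' (a + 1) (b - a - 1)).map i) (by simp) (i a) (i b))

theorem HalfCommute.swap_mem_positionSymmetries (h : HalfCommute x) {a b : ℕ} (hab : a < b)
    (hmod : a % 2 = b % 2) : swap a b ∈ positionSymmetries x :=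
  QSphere.swap_mem_positionSymmetries hab fun _ hU =>
    h.mul_word_mul (by rw [hU, Nat.odd_iff]; omega)

theorem HalfCommute.mem_positionSymmetries (h : HalfCommute x) {n : ℕ} {σ : Perm ℕ}
    (hfix : ∀ p, n ≤ p → σ p = p) (hσ : ∀ p, σ p % 2 = p % 2) : σ ∈ positionSymmetries x := by
  induction n generalizing σ with
  | zero => exact (Equiv.ext fun p => hfix p p.zero_le : σ = 1) ▸ one_mem _
  | succ n ih =>
    obtain hn | hn | hn := lt_trichotomy (σ n) n
    · rw [← swap_mul_self_mul (σ n) n σ]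
      refine mul_mem (h.swap_mem_positionSymmetries hn (hσ n)) (ih (fun p hp => ?_) fun p => ?_)
      · obtain rfl | hp := hp.eq_or_lt
        · simp
        · rw [Perm.mul_apply, hfix p hp, swap_apply_of_ne_of_ne] <;> omega
      · have := hσ n
        have := hσ p
        rw [Perm.mul_apply, swap_apply_def]
        grind
    · refine ih (fun p hp => ?_) hσ
      obtain rfl | hp := hp.eq_or_lt
      exacts [hn, hfix p hp]
    · exact absurd (σ.injective (hfix _ hn)) hn.ne'

section Classification

variable [Fintype ι] (hx : ∑ i, x i * x i = 1)
include hx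

theorem mul_word_mul_of_swap_mem {a b : ℕ} (hab : a < b) (h : swap a b ∈ positionSymmetries x)
    (U : List ι) (hU : U.length = b - a - 1) (p q : ι) :
    x p * word x U * x q = x q * word x U * x p := by
  obtain ⟨n, hn, hb⟩ :=
    ((word_eq_of_mem_positionSymmetries h).and (eventually_gt_atTop b)).exists
  refine eq_of_word_mul_eq hx a fun P hP => eq_of_mul_word_eq hx (n - b - 1) fun Q hQ => ?_
  have := hn (P ++ p :: U ++ q :: Q) (P ++ q :: U ++ p :: Q) (by grind) (by grind) fun m _ => by
    rw [swap_apply_def]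
    split_ifs <;> grind
  simpa [mul_assoc] using this

theorem mul_word_mul_word_mul_of_cycle_mem {a b c : ℕ} (hab : a < b) (hbc : b < c)
    (h : swap b a * swap c a ∈ positionSymmetries x) (U V : List ι) (hU : U.length = b - a - 1)
    (hV : V.length = c - b - 1) (p q r : ι) :
    x p * word x U * x q * word x V * x r = x r * word x U * x p * word x V * x q := by
  obtain ⟨n, hn, hc⟩ :=
    ((word_eq_of_mem_positionSymmetries h).and (eventually_gt_atTop c)).exists
  refine eq_of_word_mul_eq hx a fun P hP => eq_of_mul_word_eq hx (n - c - 1) fun Q hQ => ?_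
  have := hn (P ++ p :: U ++ q :: V ++ r :: Q) (P ++ r :: U ++ p :: V ++ q :: Q) (by grind)
    (by grind) fun m _ => by
      clear hn h hx
      have key : (swap b a * swap c a) m = if m = a then c else if m = b then a
          else if m = c then b else m := by
        grind [Perm.mul_apply]
      rw [key]
      split_ifs <;> grind
  simpa [mul_assoc] using this

theorem halfCommute_of_mul_word_mul_word_mul {u v : ℕ}
    (h : ∀ U V : List ι, U.length = u → V.length = v → ∀ p q r,
      x p * word x U * x q * word x V * x r = x r * word x U * x p * word x V * x q) :
    HalfCommute x := by
  have hmod (U V : List ι) (hU : U.length = u % 2) (hV : V.length = v % 2) (p q r : ι) :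
      x p * word x U * x q * word x V * x r = x r * word x U * x p * word x V * x q := by
    refine mul_word_mul_eq_of_capped hx (v / 2) (fun V' hV' => ?_) V hV
    have := mul_word_mul_eq_of_capped hx (a := x p) (b := x q * word x V' * x r) (c := x r)
      (d := x p * word x V' * x q) (u / 2)
      (fun U' hU' => by
        simpa only [mul_assoc] using h U' V' (by omega) (by omega) p q r) U hU
    simpa only [mul_assoc] using this
  rcases Nat.mod_two_eq_zero_or_one u with hu | hu <;>
    rcases Nat.mod_two_eq_zero_or_one v with hv | hv
  · have hrot (p q r) : x p * x q * x r = x r * x p * x q := by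
      simpa using hmod [] [] (by simp [hu]) (by simp [hv]) p q r
    refine PairwiseCommute.halfCommute fun p q => ?_
    have := mul_eq_mul_of_forall_sq hx (a := x p * x q) (b := 1) (c := x q) (d := x p) fun s =>
      calc x p * x q * (x s * x s) * 1 = x q * (x s * x p * x s) := by
            rw [mul_one, ← mul_assoc, hrot p, hrot s]; simp only [mul_assoc]
        _ = x q * (x s * x s) * x p := by rw [hrot s p s]; simp only [mul_assoc]
    simpa only [mul_one] using this
  · refine PairwiseCommute.halfCommute fun p r => ?_
    have := mul_eq_mul_of_forall_sq hx (a := x p) (b := x r) (c := x r * x p) (d := 1) fun s => by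
      simpa [mul_assoc] using hmod [] [s] (by simp [hu]) (by simp [hv]) p s r
    simpa only [mul_one] using this
  · refine PairwiseCommute.halfCommute fun q r => ?_
    have := mul_eq_mul_of_forall_sq hx (a := 1) (b := x q * x r) (c := x r) (d := x q) fun s => by
      simpa [mul_assoc] using hmod [s] [] (by simp [hu]) (by simp [hv]) s q r
    simpa only [one_mul] using this
  · intro p q r
    have := mul_eq_mul_of_forall_sq hx (a := x p * x q) (b := x r) (c := x r * x q * x p) (d := 1)
      fun s => by simpa [mul_assoc] using hmod [q] [s] (by simp [hu]) (by simp [hv]) p s r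
    simpa only [mul_one] using this

theorem halfCommute_of_mem_positionSymmetries {σ : Perm ℕ} (hσ : σ ∈ positionSymmetries x)
    (hne : σ ≠ 1) : HalfCommute x := by
  obtain ⟨n, hn⟩ := eventually_atTop.1 hσ
  have hfix (p : ℕ) (hp : n ≤ p) : σ p = p := (hn p hp).1
  set S := {p | σ p ≠ p}
  have hS : S.Nonempty := by
    by_contra h
    exact hne (Equiv.ext fun p => not_not.1 fun hp => h ⟨p, hp⟩)
  have hbdd : BddAbove S := ⟨n, fun p hp => le_of_not_ge fun h => hp (hfix p h)⟩
  obtain ⟨a, ha, hlow⟩ : ∃ a, σ a ≠ a ∧ ∀ p < a, σ p = p :=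
    ⟨sInf S, Nat.sInf_mem hS, fun p hp => not_not.1 (Nat.notMem_of_lt_sInf hp)⟩
  obtain ⟨c, hc, hhigh⟩ : ∃ c, σ c ≠ c ∧ ∀ p, c < p → σ p = p :=
    ⟨sSup S, Nat.sSup_mem hS hbdd, fun p hp => not_not.1 (notMem_of_csSup_lt hp hbdd)⟩
  have hac : a ≤ c := not_lt.1 fun h => ha (hhigh a h)
  have ha' : a < σ a := ha.lt_or_gt.resolve_left fun h => ha (σ.injective (hlow _ h))
  have hc' : σ c < c := hc.lt_or_gt.resolve_right fun h => hc (σ.injective (hhigh _ h))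
  -- The translate of `σ` moving `c` to the right meets `σ` at `c` only.
  set τ := shiftPerm (c - a) σ
  have hτ (p : ℕ) (hp : p < c) : τ p = p := by
    obtain hp | hp := lt_or_ge p (c - a)
    · exact shiftPerm_of_lt σ hp
    · obtain ⟨q, rfl⟩ := Nat.exists_eq_add_of_le hp
      rw [shiftPerm_add, hlow q (by omega)]
  have hcτ : c < τ c := by
    have : τ (c - a + a) = c - a + σ a := shiftPerm_add (c - a) σ a
    rw [Nat.sub_add_cancel hac] at this
    omega
  have hcomm : ⁅σ, τ⁆ ∈ positionSymmetries x := by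
    have hτ := shiftPerm_mem_positionSymmetries hσ (c - a)
    exact mul_mem (mul_mem (mul_mem hσ hτ) (inv_mem hσ)) (inv_mem hτ)
  rw [commutatorElement_eq_of_overlap (c := c)
    (fun p hp => hp.lt_or_gt.symm.imp (hhigh p) (hτ p)) hc] at hcomm
  exact halfCommute_of_mul_word_mul_word_mul hx
    fun U V => mul_word_mul_word_mul_of_cycle_mem hx hc' hcτ hcomm U V

theorem pairwiseCommute_of_mem_positionSymmetries {σ : Perm ℕ} (hσ : σ ∈ positionSymmetries x)
    {p : ℕ} (hp : σ p % 2 ≠ p % 2) : PairwiseCommute x := by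
  have hhalf := halfCommute_of_mem_positionSymmetries hx hσ (by rintro rfl; exact hp rfl)
  obtain ⟨q, hσq, hpq, hq, hmod⟩ : ∃ q, σ q = q ∧ p < q ∧ σ p < q ∧ p % 2 = q % 2 := by
    obtain ⟨n, hn⟩ := eventually_atTop.1 hσ
    exact ⟨p + 2 * (n + σ p + 1), (hn _ (by omega)).1, by omega, by omega, by omega⟩
  have hconj : swap (σ p) q ∈ positionSymmetries x := by
    have := mul_mem (mul_mem hσ (hhalf.swap_mem_positionSymmetries hpq hmod)) (inv_mem hσ)
    rwa [← swap_apply_apply, hσq] at this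
  have hcap (U : List ι) (hU : U.length = 0 + 2 * ((q - σ p - 1) / 2)) (i j : ι) :
      x i * word x U * x j = x j * word x U * x i :=
    mul_word_mul_of_swap_mem hx hq hconj U (by omega) i j
  exact fun i j => by
    simpa using mul_word_mul_eq_of_capped hx _ (fun U hU => hcap U hU i j) [] rfl

end Classification

/-- The relations `x_{i₁} ⋯ x_{i_k} = x_{i_{σ(1)}} ⋯ x_{i_{σ(k)}}`, for all multi-indices `i`. -/
def PermRel (x : ι → A) {k : ℕ} (σ : Perm (Fin k)) : Prop :=
  ∀ i : Fin k → ι, word x (List.ofFn i) = word x (List.ofFn (i ∘ σ))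

/-- Preservation of the parity of the positions. -/
def PreservesParity {k : ℕ} (σ : Perm (Fin k)) : Prop := ∀ p, (σ p : ℕ) % 2 = (p : ℕ) % 2

/-- The permutation `σ` of `{0, …, k - 1}`, extended to the integers by the identity. -/
def natPerm {k : ℕ} (σ : Perm (Fin k)) : Perm ℕ := σ.extendDomain Fin.equivSubtype

theorem natPerm_val {k : ℕ} (σ : Perm (Fin k)) (p : Fin k) : natPerm σ p = σ p :=
  Perm.extendDomain_apply_image σ Fin.equivSubtype p

theorem natPerm_of_le {k : ℕ} (σ : Perm (Fin k)) {p : ℕ} (hp : k ≤ p) : natPerm σ p = p :=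
  Perm.extendDomain_apply_not_subtype _ _ (by omega)

theorem PermRel.natPerm_mem_positionSymmetries {k : ℕ} {σ : Perm (Fin k)} (h : PermRel x σ) :
    natPerm σ ∈ positionSymmetries x := by
  rw [mem_positionSymmetries, ← map_add_atTop_eq_nat k, eventually_map]
  refine .of_forall fun m => ⟨natPerm_of_le σ (by omega), fun i => ?_⟩
  have hhead (j : ℕ → ι) : (List.range k).map j = List.ofFn fun p : Fin k => j p := by
    rw [List.ofFn_eq_map, ← List.map_coe_finRange_eq_range, List.map_map]; rfl
  have htail : (i ∘ natPerm σ) ∘ (k + ·) = i ∘ (k + ·) := by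
    ext p
    simp only [Function.comp_apply, natPerm_of_le σ (Nat.le_add_right k p)]
  have hσ : (fun p : Fin k => (i ∘ natPerm σ) p) = (fun p : Fin k => i p) ∘ σ := by
    ext p
    simp only [Function.comp_apply, natPerm_val]
  rw [add_comm m k, List.range_add, List.map_append, List.map_append, word_append, word_append,
    List.map_map, List.map_map, htail, hhead, hhead, hσ, h]

theorem PermRel.of_natPerm_mem_positionSymmetries [Fintype ι] (hx : ∑ i, x i * x i = 1) {k : ℕ}
    {σ : Perm (Fin k)} (h : natPerm σ ∈ positionSymmetries x) : PermRel x σ := by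
  intro i
  obtain ⟨n, hn, hkn⟩ := ((word_eq_of_mem_positionSymmetries h).and (eventually_ge_atTop k)).exists
  refine eq_of_mul_word_eq hx (n - k) fun P hP => ?_
  have := hn (List.ofFn i ++ P) (List.ofFn (i ∘ σ) ++ P) (by simp; omega) (by simp; omega)
    fun m _ => by
      obtain hm | hm := lt_or_ge m k
      · have := natPerm_val σ ⟨m, hm⟩
        simp [List.getElem?_append, this, hm]
      · simp [List.getElem?_append, natPerm_of_le σ hm, hm]
  simpa using this

theorem PairwiseCommute.permRel (h : PairwiseCommute x) {k : ℕ} (σ : Perm (Fin k)) :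
    PermRel x σ := fun i =>
  (((Perm.ofFn_comp_perm σ i).map x).prod_eq' <|
    List.pairwise_map.2 <| List.pairwise_of_forall fun p q => h p q).symm

theorem HalfCommute.permRel [Fintype ι] (h : HalfCommute x) (hx : ∑ i, x i * x i = 1) {k : ℕ}
    {σ : Perm (Fin k)} (hσ : PreservesParity σ) : PermRel x σ :=
  .of_natPerm_mem_positionSymmetries hx <|
    h.mem_positionSymmetries (fun _ => natPerm_of_le σ) fun p => by
      obtain hp | hp := lt_or_ge p k
      · simpa [← natPerm_val] using hσ ⟨p, hp⟩
      · rw [natPerm_of_le σ hp]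

theorem PermRel.halfCommute [Fintype ι] (hx : ∑ i, x i * x i = 1) {k : ℕ} {σ : Perm (Fin k)}
    (h : PermRel x σ) (hσ : σ ≠ 1) : HalfCommute x :=
  halfCommute_of_mem_positionSymmetries hx h.natPerm_mem_positionSymmetries
    fun h => hσ (Perm.extendDomain_eq_one_iff.1 h)

theorem PermRel.pairwiseCommute [Fintype ι] (hx : ∑ i, x i * x i = 1) {k : ℕ} {σ : Perm (Fin k)}
    (h : PermRel x σ) (hσ : ¬PreservesParity σ) : PairwiseCommute x := by
  obtain ⟨p, hp⟩ := not_forall.1 hσ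
  exact pairwiseCommute_of_mem_positionSymmetries hx h.natPerm_mem_positionSymmetries (p := p)
    (by rwa [natPerm_val])

/-- The three possible strengths of the relations of a set of permutations: commutation,
half-commutation, or no relation at all. -/
def Commutation (x : ι → A) (a : Fin 3) : Prop := ![PairwiseCommute x, HalfCommute x, True] a

theorem Commutation.mono {a b : Fin 3} (h : Commutation x a) (hab : a ≤ b) : Commutation x b := by
  fin_cases a <;> fin_cases b <;> first | exact h | trivial | exact h.halfCommute

open Classical in
/-- The strength of the relations of a set of permutations. -/
noncomputable def level (E : Set Permutation) : Fin 3 :=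
  if ∀ σ ∈ E, σ.2 = 1 then 2 else if ∀ σ ∈ E, PreservesParity σ.2 then 1 else 0

theorem forall_permRel_iff [Fintype ι] (hx : ∑ i, x i * x i = 1) (E : Set Permutation) :
    (∀ σ ∈ E, PermRel x σ.2) ↔ Commutation x (level E) := by
  unfold level
  split_ifs with htriv hparity
  · exact iff_of_true (fun σ hσ => htriv σ hσ ▸ fun _ => rfl) trivial
  · push Not at htriv
    obtain ⟨σ, hσ, hne⟩ := htriv
    exact ⟨fun h => (h σ hσ).halfCommute hx hne, fun h τ hτ => h.permRel hx (hparity τ hτ)⟩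
  · push Not at hparity
    obtain ⟨σ, hσ, hne⟩ := hparity
    exact ⟨fun h => (h σ hσ).pairwiseCommute hx hne, fun h τ _ => h.permRel τ.2⟩

theorem level_surjective : Function.Surjective level := by
  have hswap : ¬PreservesParity (swap (0 : Fin 2) 1) := by unfold PreservesParity; decide
  have hswap' : PreservesParity (swap (0 : Fin 3) 2) := by unfold PreservesParity; decide
  intro a
  fin_cases a
  · exact ⟨{⟨2, swap 0 1⟩}, by simp [level, hswap]⟩
  · exact ⟨{⟨3, swap 0 2⟩}, by simp [level, hswap']⟩
  · exact ⟨∅, by simp [level]⟩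

end Words

section Words

variable {ι A : Type*}

theorem even_count_left_of_disjoint [DecidableEq ι] {v w : List ι} (hvw : v.Disjoint w)
    (h : ∀ p, Even ((v ++ w).count p)) (p : ι) : Even (v.count p) := by
  by_cases hp : p ∈ v
  · simpa [List.count_eq_zero_of_not_mem (hvw hp)] using h p
  · simp [List.count_eq_zero_of_not_mem hp]

variable [Ring A] {u : ι → A}

theorem word_eq_one_of_noncrossing [DecidableEq ι] (hu : ∀ i, u i * u i = 1) (w : List ι)
    (hnc : ∀ p q, [p, q, p, q].Sublist w → p = q) (heven : ∀ p, Even (w.count p)) :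
    word u w = 1 := by
  induction hn : w.length using Nat.strong_induction_on generalizing w with
  | _ n ih =>
  rcases w with _ | ⟨s, t⟩
  · rfl
  have hs : s ∈ t := by
    by_contra hs
    simpa [List.count_eq_zero_of_not_mem hs] using heven s
  -- Between `s` and its next occurrence there are only letters which do not appear afterwards.
  obtain ⟨v, w, rfl, hv⟩ : ∃ v w, t = v ++ s :: w ∧ s ∉ v := List.eq_append_cons_of_mem hs
  have hdisjoint : v.Disjoint w := fun m hmv hmw => hv <| by
    have : [m, s, m].Sublist (v ++ s :: w) :=
      (List.singleton_sublist.2 hmv).append ((List.singleton_sublist.2 hmw).cons_cons s)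
    exact hnc s m (this.cons_cons s) ▸ hmv
  have heven' (p : ι) : Even ((v ++ w).count p) := by
    have := heven p
    grind
  have heven'' (p : ι) : Even ((w ++ v).count p) := by
    simpa only [List.perm_append_comm.count_eq p] using heven' p
  have hv1 := ih v.length (by grind) v (fun p q h => hnc p q (h.trans (by grind)))
    (even_count_left_of_disjoint hdisjoint heven') rfl
  have hw1 := ih w.length (by grind) w (fun p q h => hnc p q (h.trans (by grind)))
    (even_count_left_of_disjoint hdisjoint.symm heven'') rfl
  simp [hv1, hw1, hu]

theorem word_reverse_mul_word (hu : ∀ i, u i * u i = 1) (w : List ι) :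
    word u w.reverse * word u w = 1 := by
  induction w with
  | nil => simp
  | cons s w ih =>
    calc word u (s :: w).reverse * word u (s :: w)
        = word u w.reverse * (u s * u s) * word u w := by simp [mul_assoc]
      _ = 1 := by rw [hu, mul_one, ih]

theorem ofFn_comp_swap {k : ℕ} (f : Fin k → ι) {p q : Fin k} (hpq : (p : ℕ) + 1 = q) :
    ∃ v w, List.ofFn f = v ++ f p :: f q :: w ∧
      List.ofFn (f ∘ swap p q) = v ++ f q :: f p :: w := by
  refine ⟨(List.ofFn f).take p, (List.ofFn f).drop (p + 2), ?_, ?_⟩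
  · apply List.ext_getElem <;> grind
  · apply List.ext_getElem <;> grind

end Words

section Signature

variable {k l N : ℕ} {C : Type*} [Ring C] {u : Fin N → C}

/-- The indices of a two-row multi-index, read clockwise from top left. -/
def clockwiseWord (i : Fin k → Fin N) (j : Fin l → Fin N) : List (Fin N) :=
  List.ofFn i ++ (List.ofFn j).reverse

theorem comap_kernel_upper (i : Fin k → Fin N) (j : Fin l → Fin N) (p q : Fin k) :
    (kernel i j).comap (swap (.inl p) (.inl q)) = kernel (i ∘ swap p q) j := by
  have h : Sum.elim i j ∘ swap (.inl p) (.inl q) = Sum.elim (i ∘ swap p q) j := by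
    ext (a | a) <;> grind
  rw [kernel, kernel, ← h]
  rfl

theorem comap_kernel_lower (i : Fin k → Fin N) (j : Fin l → Fin N) (p q : Fin l) :
    (kernel i j).comap (swap (.inr p) (.inr q)) = kernel i (j ∘ swap p q) := by
  have h : Sum.elim i j ∘ swap (.inr p) (.inr q) = Sum.elim i (j ∘ swap p q) := by
    ext (a | a) <;> grind
  rw [kernel, kernel, ← h]
  rfl

theorem word_clockwiseWord_comp_swap_upper (hu : ∀ i j, i ≠ j → u i * u j = -(u j * u i))
    {i : Fin k → Fin N} (j : Fin l → Fin N) {p q : Fin k} (hpq : (p : ℕ) + 1 = q)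
    (hne : i p ≠ i q) : word u (clockwiseWord i j) = -word u (clockwiseWord (i ∘ swap p q) j) := by
  obtain ⟨v, w, hi, hi'⟩ := ofFn_comp_swap i hpq
  simp only [clockwiseWord, hi, hi', word_append, word_cons]
  rw [← mul_assoc (u (i p)), hu _ _ hne]
  noncomm_ring

theorem word_clockwiseWord_comp_swap_lower (hu : ∀ i j, i ≠ j → u i * u j = -(u j * u i))
    (i : Fin k → Fin N) {j : Fin l → Fin N} {p q : Fin l} (hpq : (p : ℕ) + 1 = q)
    (hne : j p ≠ j q) : word u (clockwiseWord i j) = -word u (clockwiseWord i (j ∘ swap p q)) := by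
  obtain ⟨v, w, hj, hj'⟩ := ofFn_comp_swap j hpq
  simp only [clockwiseWord, hj, hj', List.reverse_append, List.reverse_cons, List.append_assoc,
    word_append, word_cons, word_nil, mul_one]
  rw [← mul_assoc (u (j q)), hu _ _ hne.symm]
  noncomm_ring

theorem SwitchesTo.exists_kernel (hu : ∀ i j, i ≠ j → u i * u j = -(u j * u i)) {c : ℕ}
    {π ρ : Setoid (Fin k ⊕ Fin l)} (h : SwitchesTo c π ρ) {i : Fin k → Fin N} {j : Fin l → Fin N}
    (hπ : π = kernel i j) :
    ∃ i' j', ρ = kernel i' j' ∧ (clockwiseWord i j).Perm (clockwiseWord i' j') ∧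
      word u (clockwiseWord i j) = (-1) ^ c * word u (clockwiseWord i' j') := by
  induction h generalizing i j with
  | refl π => exact ⟨i, j, hπ, .refl _, by simp⟩
  | upper p q hpq hblock h ih =>
    subst hπ
    obtain ⟨i', j', hρ, hperm, hword⟩ := ih (comap_kernel_upper i j p q)
    refine ⟨i', j', hρ, .trans (((swap p q).ofFn_comp_perm i).symm.append_right _) hperm, ?_⟩
    rw [word_clockwiseWord_comp_swap_upper hu j hpq hblock, hword, pow_succ', neg_mul, one_mul,
      neg_mul]
  | lower p q hpq hblock h ih =>
    subst hπ
    obtain ⟨i', j', hρ, hperm, hword⟩ := ih (comap_kernel_lower i j p q)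
    have hrow : (List.ofFn j).reverse.Perm (List.ofFn (j ∘ swap p q)).reverse :=
      (List.reverse_perm _).trans
        (((swap p q).ofFn_comp_perm j).symm.trans (List.reverse_perm _).symm)
    refine ⟨i', j', hρ, .trans (hrow.append_left _) hperm, ?_⟩
    rw [word_clockwiseWord_comp_swap_lower hu i hpq hblock, hword, pow_succ', neg_mul, one_mul,
      neg_mul]

theorem isNoncrossing_kernel_of_monotone {i : Fin k → Fin N} {j : Fin l → Fin N}
    (hi : Monotone i) (hj : Monotone j) : IsNoncrossing (kernel i j) := by
  have hle (a b c : Fin k ⊕ Fin l) (hab : clockwise a < clockwise b)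
      (hbc : clockwise b < clockwise c) (hac : Sum.elim i j a = Sum.elim i j c) :
      Sum.elim i j a ≤ Sum.elim i j b := by
    rcases b with b | b
    · rcases a with a | a
      · exact hi (Fin.le_def.2 hab.le)
      · grind [clockwise]
    · rw [hac]
      rcases c with c | c
      · grind [clockwise]
      · exact hj (Fin.le_def.2 (by grind [clockwise]))
  exact fun a b c d hab hbc hcd hac hbd =>
    le_antisymm (hle a b c hab hbc hac) ((hle b c d hbc hcd hbd).trans_eq hac.symm)

theorem exists_lt_of_not_monotone {i : Fin k → Fin N} (hi : ¬Monotone i) :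
    ∃ p q : Fin k, (p : ℕ) + 1 = q ∧ i q < i p := by
  contrapose! hi
  rcases k with _ | k
  · exact Subsingleton.monotone i
  · exact Fin.monotone_iff_le_succ.2 fun p => hi _ _ (by simp)

theorem toLex_comp_swap_lt {i : Fin k → Fin N} {p q : Fin k} (hpq : (p : ℕ) + 1 = q)
    (h : i q < i p) : toLex (i ∘ swap p q) < toLex i := by
  refine ⟨p, fun r hr => ?_, by simpa using h⟩
  have hrq : r ≠ q := by
    rintro rfl
    exact absurd (Fin.lt_def.1 hr) (by omega)
  simp [swap_apply_of_ne_of_ne hr.ne hrq]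

theorem exists_switchesTo_isNoncrossing (i : Fin k → Fin N) (j : Fin l → Fin N) :
    ∃ c ρ, SwitchesTo c (kernel i j) ρ ∧ IsNoncrossing ρ := by
  generalize hm : toLex (toLex i, toLex j) = m
  induction m using WellFoundedLT.induction generalizing i j with
  | _ m ih =>
  subst hm
  by_cases hi : Monotone i
  · by_cases hj : Monotone j
    · exact ⟨0, _, .refl _, isNoncrossing_kernel_of_monotone hi hj⟩
    · obtain ⟨p, q, hpq, hlt⟩ := exists_lt_of_not_monotone hj
      obtain ⟨c, ρ, hc, hρ⟩ :=
        ih _ (Prod.Lex.right _ (toLex_comp_swap_lt hpq hlt)) i (j ∘ swap p q) rfl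
      rw [← comap_kernel_lower] at hc
      exact ⟨c + 1, ρ, .lower p q hpq (fun h => hlt.ne' h) hc, hρ⟩
  · obtain ⟨p, q, hpq, hlt⟩ := exists_lt_of_not_monotone hi
    obtain ⟨c, ρ, hc, hρ⟩ :=
      ih _ (Prod.Lex.left _ _ (toLex_comp_swap_lt hpq hlt)) (i ∘ swap p q) j rfl
    rw [← comap_kernel_upper] at hc
    exact ⟨c + 1, ρ, .upper p q hpq (fun h => hlt.ne' h) hc, hρ⟩

theorem exists_leg (i : Fin k → Fin N) (j : Fin l → Fin N) (m : Fin (clockwiseWord i j).length) :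
    ∃ a : Fin k ⊕ Fin l, clockwise a = m ∧ Sum.elim i j a = (clockwiseWord i j)[m] := by
  have hm : (m : ℕ) < k + l := by simpa [clockwiseWord] using m.2
  by_cases h : (m : ℕ) < k
  · exact ⟨.inl ⟨m, h⟩, rfl, by grind [clockwiseWord]⟩
  · refine ⟨.inr (Fin.rev ⟨m - k, by omega⟩), ?_, ?_⟩
    · grind [clockwise]
    · grind [clockwiseWord]

theorem IsNoncrossing.eq_of_sublist {i : Fin k → Fin N} {j : Fin l → Fin N}
    (h : IsNoncrossing (kernel i j)) {p q : Fin N}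
    (hs : [p, q, p, q].Sublist (clockwiseWord i j)) : p = q := by
  obtain ⟨f, hf⟩ := List.sublist_iff_exists_fin_orderEmbedding_get_eq.1 hs
  choose leg hleg hindex using fun m => exists_leg i j (f m)
  have hlt {m n} (hmn : m < n) : clockwise (leg m) < clockwise (leg n) := by
    rw [hleg, hleg]
    exact f.lt_iff_lt.2 hmn
  have hval (m) : Sum.elim i j (leg m) = [p, q, p, q].get m := (hindex m).trans (hf m).symm
  have := h (leg 0) (leg 1) (leg 2) (leg 3) (hlt (by simp)) (hlt (by simp [Fin.lt_def]))
    (hlt (by simp [Fin.lt_def])) ((hval 0).trans (hval 2).symm)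
    ((hval 1).trans (hval 3).symm)
  exact (hval 0).symm.trans (this.trans (hval 1))

theorem intCast_signature_kernel (hu1 : ∀ i, u i * u i = 1)
    (hu : ∀ i j, i ≠ j → u i * u j = -(u j * u i)) (i : Fin k → Fin N) (j : Fin l → Fin N)
    (heven : ∀ p, Even ((clockwiseWord i j).count p)) :
    (signature (kernel i j) : C) = word u (clockwiseWord i j) := by
  have hpow (c ρ) (hc : SwitchesTo c (kernel i j) ρ) (hρ : IsNoncrossing ρ) :
      word u (clockwiseWord i j) = (-1) ^ c := by
    obtain ⟨i', j', rfl, hperm, hword⟩ := hc.exists_kernel hu rfl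
    rw [hword, word_eq_one_of_noncrossing hu1 _ (fun _ _ => hρ.eq_of_sublist)
      fun p => hperm.count_eq p ▸ heven p, mul_one]
  rw [signature]
  split_ifs with h
  · obtain ⟨c, ρ, heven, hc, hρ⟩ := h
    rw [hpow c ρ hc hρ, heven.neg_one_pow, Int.cast_one]
  · obtain ⟨c, ρ, hc, hρ⟩ := exists_switchesTo_isNoncrossing i j
    have hodd : Odd c := Nat.not_even_iff_odd.1 fun heven => h ⟨c, ρ, heven, hc, hρ⟩
    rw [hpow c ρ hc hρ, hodd.neg_one_pow, Int.cast_neg, Int.cast_one]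

theorem word_eq_signature_mul (hu1 : ∀ i, u i * u i = 1)
    (hu : ∀ i j, i ≠ j → u i * u j = -(u j * u i)) (i : Fin k → Fin N) (σ : Perm (Fin k)) :
    word u (List.ofFn i) = (signature (kernel i (i ∘ σ)) : C) * word u (List.ofFn (i ∘ σ)) := by
  have heven (p : Fin N) : Even ((clockwiseWord i (i ∘ σ)).count p) := by
    rw [clockwiseWord, List.count_append, List.count_reverse, (σ.ofFn_comp_perm i).count_eq]
    exact ⟨_, rfl⟩
  rw [intCast_signature_kernel hu1 hu _ _ heven, clockwiseWord, word_append, mul_assoc,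
    word_reverse_mul_word hu1, mul_one]

theorem signature_mul_self (π : Setoid (Fin k ⊕ Fin l)) : signature π * signature π = 1 := by
  rw [signature]
  split_ifs <;> rfl

end Signature

section Twist

variable {N : ℕ}

/-- The Clifford algebra generated by `N` anticommuting symmetries. -/
abbrev Clifford (N : ℕ) : Type :=
  CliffordAlgebra (QuadraticMap.weightedSumSquares ℂ (fun _ : Fin N => (1 : ℂ)))

/-- The standard generators of the Clifford algebra. -/
noncomputable def gen (i : Fin N) : Clifford N := CliffordAlgebra.ι _ (Pi.single i 1)

theorem gen_mul_self (i : Fin N) : gen i * gen i = 1 := by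
  rw [gen, CliffordAlgebra.ι_sq_scalar]
  simp [QuadraticMap.weightedSumSquares_apply, Pi.single_apply]

theorem gen_mul_gen {i j : Fin N} (hij : i ≠ j) : gen i * gen j = -(gen j * gen i) := by
  rw [gen, gen, CliffordAlgebra.ι_mul_ι_comm_of_isOrtho]
  simp only [QuadraticMap.isOrtho_def, QuadraticMap.weightedSumSquares_apply, Pi.add_apply,
    ← Finset.sum_add_distrib]
  refine Finset.sum_congr rfl fun k _ => ?_
  by_cases hi : k = i
  · subst hi
    simp [hij]
  · simp [Pi.single_apply, hi]

theorem gen_mul_gen_mul_gen_of_distinct {i j k : Fin N} (h : i ≠ j ∧ j ≠ k ∧ i ≠ k) :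
    gen i * gen j * gen k = -(gen k * gen j * gen i) := by
  rw [gen_mul_gen h.1, neg_mul, mul_assoc, gen_mul_gen h.2.2, mul_neg, ← mul_assoc,
    gen_mul_gen h.2.1, neg_mul, neg_neg]

theorem gen_mul_gen_mul_gen_of_not_distinct {i j k : Fin N} (h : ¬(i ≠ j ∧ j ≠ k ∧ i ≠ k)) :
    gen i * gen j * gen k = gen k * gen j * gen i := by
  obtain rfl | rfl | rfl : i = j ∨ j = k ∨ i = k := by tauto
  · rw [gen_mul_self, one_mul, mul_assoc, gen_mul_self, mul_one]
  · rw [gen_mul_self, one_mul, mul_assoc, gen_mul_self, mul_one]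
  · rfl

variable {A : Type*} [Ring A] [Algebra ℂ A] {x : Fin N → A}

/-- The twist of a family by anticommuting symmetries, which turns the twisted relations into
untwisted ones. -/
noncomputable def twist (x : Fin N → A) (i : Fin N) : A ⊗[ℂ] Clifford N := x i ⊗ₜ gen i

theorem sum_twist_sq (hx : ∑ i, x i * x i = 1) : ∑ i, twist x i * twist x i = 1 := by
  simp only [twist, Algebra.TensorProduct.tmul_mul_tmul, gen_mul_self, ← TensorProduct.sum_tmul, hx]
  rfl

theorem word_twist (w : List (Fin N)) : word (twist x) w = word x w ⊗ₜ word gen w := by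
  induction w with
  | nil => rfl
  | cons i w ih => simp [ih, twist]

theorem tmul_word_gen_injective (w : List (Fin N)) :
    Function.Injective fun a : A => a ⊗ₜ[ℂ] word gen w := fun a b h => by
  have hinv : word gen w * word gen w.reverse = (1 : Clifford N) := by
    simpa using word_reverse_mul_word gen_mul_self w.reverse
  have := congrArg (· * (1 : A) ⊗ₜ[ℂ] word gen w.reverse) h
  simp only [Algebra.TensorProduct.tmul_mul_tmul, hinv, mul_one] at this
  exact Algebra.TensorProduct.includeLeft_injective (R := ℂ) (S := ℂ) (A := A) (B := Clifford N)
    (algebraMap ℂ (Clifford N)).injective this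

theorem word_twist_eq_iff {v w : List (Fin N)} {s : ℤ} (hs : s * s = 1)
    (h : word gen v = (s : Clifford N) * word gen w) :
    word (twist x) v = word (twist x) w ↔ word x v = s • word x w := by
  have htmul : word x v ⊗ₜ[ℂ] ((s : Clifford N) * word gen w) =
      (s • word x v) ⊗ₜ[ℂ] word gen w := by
    rw [← zsmul_eq_mul, ← Int.cast_smul_eq_zsmul ℂ, ← Int.cast_smul_eq_zsmul ℂ,
      TensorProduct.tmul_smul, TensorProduct.smul_tmul']
  rw [word_twist, word_twist, h, htmul, (tmul_word_gen_injective w).eq_iff]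
  constructor <;> intro h
  · rw [← h, smul_smul, hs, one_smul]
  · rw [h, smul_smul, hs, one_smul]

theorem permRel_twist_iff {k : ℕ} (σ : Perm (Fin k)) :
    PermRel (twist x) σ ↔ ∀ i : Fin k → Fin N,
      word x (List.ofFn i) = signature (kernel i (i ∘ σ)) • word x (List.ofFn (i ∘ σ)) :=
  forall_congr' fun i => word_twist_eq_iff (signature_mul_self _)
    (word_eq_signature_mul gen_mul_self (fun _ _ => gen_mul_gen) i σ)

theorem pairwiseCommute_twist_iff :
    PairwiseCommute (twist x) ↔ ∀ i j, i ≠ j → x i * x j = -(x j * x i) := by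
  have hiff {i j : Fin N} (hij : i ≠ j) :
      twist x i * twist x j = twist x j * twist x i ↔ x i * x j = -(x j * x i) := by
    simpa using word_twist_eq_iff (x := x) (v := [i, j]) (w := [j, i]) (s := -1) (by norm_num)
      (by simpa using gen_mul_gen hij)
  refine ⟨fun h i j hij => (hiff hij).1 (h i j), fun h i j => ?_⟩
  obtain rfl | hij := eq_or_ne i j
  exacts [rfl, (hiff hij).2 (h i j hij)]

theorem halfCommute_twist_iff :
    HalfCommute (twist x) ↔
      (∀ i j k, i ≠ j ∧ j ≠ k ∧ i ≠ k → x i * x j * x k = -(x k * x j * x i)) ∧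
      (∀ i j k, ¬(i ≠ j ∧ j ≠ k ∧ i ≠ k) → x i * x j * x k = x k * x j * x i) := by
  have hneg {i j k : Fin N} (h : i ≠ j ∧ j ≠ k ∧ i ≠ k) :
      twist x i * twist x j * twist x k = twist x k * twist x j * twist x i ↔
        x i * x j * x k = -(x k * x j * x i) := by
    simpa [mul_assoc] using word_twist_eq_iff (x := x) (v := [i, j, k]) (w := [k, j, i]) (s := -1)
      (by norm_num) (by simpa [mul_assoc] using gen_mul_gen_mul_gen_of_distinct h)
  have hpos {i j k : Fin N} (h : ¬(i ≠ j ∧ j ≠ k ∧ i ≠ k)) :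
      twist x i * twist x j * twist x k = twist x k * twist x j * twist x i ↔
        x i * x j * x k = x k * x j * x i := by
    simpa [mul_assoc] using word_twist_eq_iff (x := x) (v := [i, j, k]) (w := [k, j, i]) (s := 1)
      (by norm_num) (by simpa [mul_assoc] using gen_mul_gen_mul_gen_of_not_distinct h)
  refine ⟨fun h => ⟨fun i j k hd => (hneg hd).1 (h i j k), fun i j k hd => (hpos hd).1 (h i j k)⟩,
    fun h i j k => ?_⟩
  by_cases hd : i ≠ j ∧ j ≠ k ∧ i ≠ k
  exacts [(hneg hd).2 (h.1 i j k hd), (hpos hd).2 (h.2 i j k hd)]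

end Twist

section Quotient

variable {A : Type*} [NormedRing A] {J : Ideal A} [J.IsTwoSided]

theorem norm_quotient_mul_le (x y : A ⧸ J) : ‖x * y‖ ≤ ‖x‖ * ‖y‖ := by
  have hle {ε : ℝ} (hε : 0 < ε) : ‖x * y‖ ≤ (‖x‖ + ε) * (‖y‖ + ε) := by
    obtain ⟨a, rfl, ha⟩ := Submodule.Quotient.norm_mk_lt x hε
    obtain ⟨b, rfl, hb⟩ := Submodule.Quotient.norm_mk_lt y hε
    calc _ ≤ ‖a * b‖ := Submodule.Quotient.norm_mk_le J (a * b)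
      _ ≤ ‖a‖ * ‖b‖ := norm_mul_le a b
      _ ≤ _ := by gcongr
  have hlim : Tendsto (fun ε : ℝ => (‖x‖ + ε) * (‖y‖ + ε)) (nhdsWithin 0 (Set.Ioi 0))
      (nhds (‖x‖ * ‖y‖)) := by
    have : Continuous fun ε : ℝ => (‖x‖ + ε) * (‖y‖ + ε) := by fun_prop
    simpa using (this.tendsto 0).mono_left nhdsWithin_le_nhds
  exact ge_of_tendsto hlim (eventually_mem_nhdsWithin.mono fun _ => hle)

theorem exists_mul_sub_one_mem [NormedAlgebra ℂ A] [CompleteSpace A] (hJ : IsClosed (J : Set A))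
    (hcomm : ∀ a b : A, a * b - b * a ∈ J) {c : A} (hc : ∀ χ : A →ₐ[ℂ] ℂ, χ c ≠ 0) :
    ∃ d, c * d - 1 ∈ J := by
  let _ : NormedCommRing (A ⧸ J) :=
    { Submodule.Quotient.normedAddCommGroup J, Ideal.Quotient.ring J with
      norm_mul_le := norm_quotient_mul_le
      mul_comm := Quotient.ind₂ fun a b => Ideal.Quotient.eq.2 (hcomm a b) }
  let _ : NormedAlgebra ℂ (A ⧸ J) :=
    { (inferInstance : Algebra ℂ (A ⧸ J)) with
      norm_smul_le := (Submodule.Quotient.normedSpace J ℂ).norm_smul_le }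
  have : CompleteSpace (A ⧸ J) := Submodule.Quotient.completeSpace J
  let π : A →ₐ[ℂ] A ⧸ J := { Ideal.Quotient.mk J with commutes' := fun _ => rfl }
  have hunit : IsUnit (π c) := by
    by_contra h
    obtain ⟨χ, hχ⟩ := WeakDual.CharacterSpace.exists_apply_eq_zero h
    exact hc ((WeakDual.CharacterSpace.toAlgHom χ).comp π) hχ
  obtain ⟨y, hy⟩ := hunit.exists_right_inv
  obtain ⟨d, rfl⟩ := Ideal.Quotient.mk_surjective y
  exact ⟨d, Ideal.Quotient.eq.1 hy⟩

end Quotient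

section Spectral

variable {A B : Type*} [CStarAlgebra A] [CStarAlgebra B]

theorem norm_mul_cfc_sq_le (a : A) {f : ℝ → ℝ} (hf : Continuous f) {C : ℝ}
    (hC : ∀ t, 0 ≤ t → t * f t ^ 2 ≤ C) : ‖a * cfc f (star a * a)‖ ^ 2 ≤ C := by
  have hmul : star (a * cfc f (star a * a)) * (a * cfc f (star a * a)) =
      cfc (fun t => t * f t ^ 2) (star a * a) := by
    have hsa : star (cfc f (star a * a)) = cfc f (star a * a) :=
      (cfc_predicate (R := ℝ) f (star a * a)).star_eq
    calc _ = cfc f (star a * a) * (star a * a * cfc f (star a * a)) := by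
          rw [star_mul, hsa]
          simp only [mul_assoc]
      _ = cfc f (star a * a) * (cfc (fun t => t) (star a * a) * cfc f (star a * a)) := by
          rw [cfc_id' ℝ (star a * a)]
      _ = cfc (fun t => f t * (t * f t)) (star a * a) := by
          rw [cfc_mul f (fun t => t * f t) _ hf.continuousOn (by fun_prop),
            cfc_mul (fun t => t) f _ continuousOn_id hf.continuousOn]
      _ = _ := cfc_congr fun t _ => by ring
  rw [sq, ← CStarRing.norm_star_mul_self, hmul]
  refine norm_cfc_le (by simpa using hC 0 le_rfl) fun t ht => ?_
  have ht : 0 ≤ t := spectrum_star_mul_self_nonneg t ht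
  rw [Real.norm_of_nonneg (by positivity)]
  exact hC t ht

theorem exists_bump_and_cutoff {δ : ℝ} (hδ : 0 < δ) :
    ∃ w g : ℝ → ℝ, Continuous w ∧ Continuous g ∧ w 0 = 1 ∧ (∀ t, g t * w t = w t) ∧
      ∀ t, 0 ≤ t → t * g t ^ 2 ≤ 2 * δ := by
  refine ⟨fun t => max 0 (1 - t / δ), fun t => min 1 (max 0 (2 - t / δ)), by fun_prop, by fun_prop,
    by simp, fun t => ?_, fun t ht => ?_⟩
  · rcases le_total (1 - t / δ) 0 with ht | ht
    · simp [max_eq_left ht]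
    · have : 1 ≤ 2 - t / δ := by linarith
      simp [this]
  · rcases le_total (2 - t / δ) 0 with h | h
    · simp [h, hδ.le]
    · rw [sub_nonneg, div_le_iff₀ hδ] at h
      exact (mul_le_of_le_one_right ht
        (pow_le_one₀ (by positivity) (min_le_left _ _))).trans h

open scoped CStarAlgebra in
theorem mem_of_map_eq_zero (π : A →⋆ₐ[ℂ] B) {J : Ideal A} (hJ : IsClosed (J : Set A))
    (hπ : ∀ c, π c = 1 → ∃ d, c * d - 1 ∈ J) {a : A} (ha : π a = 0) : a ∈ J := by
  rw [← SetLike.mem_coe, ← hJ.closure_eq, Metric.mem_closure_iff]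
  intro ε hε
  obtain ⟨δ, hδ, hδε⟩ : ∃ δ > 0, 2 * δ < ε ^ 2 :=
    ⟨ε ^ 2 / 4, by positivity, by linarith [sq_pos_of_pos hε]⟩
  obtain ⟨w, g, hw, hg, hw0, hgw, hbound⟩ := exists_bump_and_cutoff hδ
  set h := star a * a
  obtain ⟨d, hd⟩ := hπ (cfc w h) (by
    rw [StarAlgHomClass.map_cfc π w h (hφ := map_continuous π)]
    simp [h, ha, hw0])
  -- `1 - g` is killed by `w`, which is invertible modulo `J`.
  have hmem : 1 - cfc g h ∈ J := by
    have hprod : cfc g h * cfc w h = cfc w h := by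
      rw [← cfc_mul g w h hg.continuousOn hw.continuousOn]
      exact cfc_congr fun t _ => hgw t
    have := J.mul_mem_left (cfc g h - 1) hd
    rwa [mul_sub, sub_mul, ← mul_assoc, hprod, one_mul, sub_self, zero_sub, mul_one, neg_sub]
      at this
  refine ⟨a * (1 - cfc g h), J.mul_mem_left a hmem, ?_⟩
  rw [dist_eq_norm, mul_sub, mul_one, sub_sub_cancel]
  refine lt_of_pow_lt_pow_left₀ 2 hε.le ((norm_mul_cfc_sq_le a hg hbound).trans_lt hδε)

end Spectral

section Order

variable {N : ℕ} {R : Set (FreeAlg N)} {S T U : Subspace N}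

instance : PartialOrder (Subspace N) where
  toLE := inferInstance
  le_refl S := le_refl S.ideal
  le_trans _ _ _ hST hTU := le_trans (α := TwoSidedIdeal (FreeAlg N)) hTU hST
  le_antisymm _ _ hST hTS := Subspace.ext (le_antisymm hTS hST)

theorem le_ofRelations_iff : T ≤ ofRelations R ↔ ∀ r ∈ R, r ∈ T.ideal :=
  ⟨fun h _ hr => h ((TwoSidedIdeal.mem_sInf _).2 fun _ hI => hI.2 hr),
    fun h => sInf_le (a := T.ideal) ⟨T.isClosed, h⟩⟩

theorem le_inter_iff : T ≤ inter S U ↔ T ≤ S ∧ T ≤ U := by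
  simp only [inter, le_ofRelations_iff, Set.mem_union, or_imp, forall_and]
  rfl

theorem le_freeSphere : T ≤ freeSphere N := le_ofRelations_iff.2 fun _ => False.elim

end Order

section Presents

variable {N : ℕ} {B : Type*} [Ring B] [Algebra ℂ B] {f : FreeAlg N →ₐ[ℂ] B} {S T : Subspace N}

/-- The range of `f` is a model of `C(T)`: the kernel of `f` is the ideal defining `T`. -/
def Presents (f : FreeAlg N →ₐ[ℂ] B) (T : Subspace N) : Prop := ∀ a, f a = 0 ↔ a ∈ T.ideal

theorem presents_mkₐ (T : Subspace N) :
    Presents (Ideal.Quotient.mkₐ ℂ T.ideal.asIdeal) T := fun _ =>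
  Ideal.Quotient.eq_zero_iff_mem.trans TwoSidedIdeal.mem_asIdeal

theorem presents_ofHom {A : Type*} [CStarAlgebra A] (g : FreeAlg N →⋆ₐ[ℂ] A) :
    Presents g.toAlgHom (ofHom g) := fun _ => (TwoSidedIdeal.mem_ker _).symm

theorem Presents.map_eq_iff (hf : Presents f T) {a b : FreeAlg N} :
    f a = f b ↔ a - b ∈ T.ideal := by
  rw [← hf, map_sub, sub_eq_zero]

theorem subalgebra_eq_top_of_coord_mem (S : Subalgebra ℂ (FreeAlg N))
    (hS : IsClosed (S : Set (FreeAlg N))) (h : ∀ i, coord i ∈ S) : S = ⊤ := by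
  let val : FreeAlg N →ₐ[ℂ] Ambient N := (freeSubalgebra N).subtype.toAlgHom
  have hclosed : IsClosed (val '' S) :=
    ((inferInstance : IsClosed (freeSubalgebra N : Set (Ambient N)))
      |>.isClosedEmbedding_subtypeVal.isClosedMap) _ hS
  have hadjoin : (StarAlgebra.adjoin ℂ (Set.range (ambientCoord N))).toSubalgebra ≤ S.map val := by
    rw [StarAlgebra.adjoin_toSubalgebra, Algebra.adjoin_le_iff]
    rintro a (⟨i, rfl⟩ | ⟨i, hi⟩)
    · exact ⟨coord i, h i, rfl⟩
    · exact ⟨coord i, h i, by rw [← star_star a, ← hi]; exact congrArg val (star_coord i).symm⟩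
  refine Algebra.eq_top_iff.2 fun a => ?_
  obtain ⟨b, hb, hba⟩ := closure_minimal (s := StarAlgebra.adjoin ℂ (Set.range (ambientCoord N)))
    hadjoin hclosed a.2
  exact (Subtype.ext hba : b = a) ▸ hb

theorem Presents.isClosed_comap_centralizer (hf : Presents f T) (s : Set (FreeAlg N)) :
    IsClosed ((Subalgebra.centralizer ℂ (f '' s)).comap f : Set (FreeAlg N)) := by
  have h : ((Subalgebra.centralizer ℂ (f '' s)).comap f : Set (FreeAlg N)) =
      ⋂ b ∈ s, (fun a => b * a - a * b) ⁻¹' (T.ideal : Set (FreeAlg N)) := by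
    ext a
    simp [Set.mem_centralizer_iff, ← hf.map_eq_iff]
  rw [h]
  exact isClosed_biInter fun b _ => T.isClosed.preimage (by fun_prop)

theorem Presents.commute (hf : Presents f T) (h : PairwiseCommute (f ∘ coord)) (a b : FreeAlg N) :
    Commute (f a) (f b) := by
  have hmem (s : Set (FreeAlg N)) (hs : ∀ i, ∀ b ∈ s, Commute (f b) (f (coord i))) (a) :
      ∀ b ∈ s, Commute (f b) (f a) := by
    have htop := subalgebra_eq_top_of_coord_mem _ (hf.isClosed_comap_centralizer s) (by
      simpa [Subalgebra.mem_centralizer_iff, commute_iff_eq] using hs)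
    have ha : a ∈ (Subalgebra.centralizer ℂ (f '' s)).comap f := htop ▸ Algebra.mem_top
    simpa [Subalgebra.mem_centralizer_iff, commute_iff_eq] using ha
  have hcoord (i : Fin N) (b : FreeAlg N) : Commute (f b) (f (coord i)) :=
    (hmem (Set.range coord) (by rintro i _ ⟨j, rfl⟩; exact h j i) b _ ⟨i, rfl⟩).symm
  exact hmem Set.univ (fun i b _ => hcoord i b) b a trivial

theorem toReal_coord (i : Fin N) : toReal N (coord i) = realCoord i := lift_coord _ _ _ i

theorem exists_point (χ : FreeAlg N →⋆ₐ[ℂ] ℂ) : ∃ p : UnitSphere N, ∀ a, χ a = toReal N a p := by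
  have hre (i) : ((χ (coord i)).re : ℂ) = χ (coord i) :=
    Complex.conj_eq_iff_re.1 ((map_star χ _).symm.trans (by rw [star_coord]))
  have hsum : ∑ i, (χ (coord i)).re ^ 2 = 1 := by
    have h : ((∑ i, (χ (coord i)).re ^ 2 : ℝ) : ℂ) = 1 := by
      simpa [hre, sq] using congrArg χ (sum_coord_sq N)
    exact_mod_cast h
  let p : UnitSphere N := ⟨WithLp.toLp 2 fun i => (χ (coord i)).re, by
    simp [EuclideanSpace.norm_eq, hsum]⟩
  have h : χ = (ContinuousMap.evalStarAlgHom ℂ ℂ p).comp (toReal N) := hom_ext fun i => by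
    rw [StarAlgHom.comp_apply, toReal_coord]
    exact (hre i).symm
  exact ⟨p, fun a => DFunLike.congr_fun h a⟩

theorem le_realSphere_iff (hf : Presents f T) :
    T ≤ realSphere N ↔ PairwiseCommute (f ∘ coord) := by
  refine ⟨fun h i j => ?_, fun h a ha => ?_⟩
  · have hmem : coord i * coord j - coord j * coord i ∈ (realSphere N).ideal :=
      (TwoSidedIdeal.mem_ker _).2 (by rw [map_sub, map_mul, map_mul, mul_comm, sub_self])
    simpa using hf.map_eq_iff.2 (h hmem)
  · refine TwoSidedIdeal.mem_asIdeal.1 <| mem_of_map_eq_zero (toReal N) T.isClosed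
      (fun c hc => exists_mul_sub_one_mem T.isClosed (fun a b => ?_) fun χ => ?_)
      ((TwoSidedIdeal.mem_ker _).1 ha)
    · exact TwoSidedIdeal.mem_asIdeal.2 (hf.map_eq_iff.1 (by simpa using (hf.commute h a b).eq))
    · obtain ⟨p, hp⟩ := exists_point { χ with map_star' := map_star χ }
      have : χ c = 1 := (hp c).trans (by rw [hc]; rfl)
      simp [this]

theorem sum_map_coord_sq (f : FreeAlg N →ₐ[ℂ] B) : ∑ i, (f ∘ coord) i * (f ∘ coord) i = 1 := by
  simpa using congrArg f (sum_coord_sq N)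

theorem map_monomial (f : FreeAlg N →ₐ[ℂ] B) {k : ℕ} (i : Fin k → Fin N) :
    f (monomial i) = word (f ∘ coord) (List.ofFn i) := by
  simp [monomial, word, map_list_prod, List.map_ofFn, Function.comp_def]

theorem Presents.le_ofRelations_iff (hf : Presents f T) {R : Set (FreeAlg N)} :
    T ≤ ofRelations R ↔ ∀ r ∈ R, f r = 0 :=
  QSphere.le_ofRelations_iff.trans <| forall₂_congr fun r _ => (hf r).symm

theorem le_halfSphere_iff (hf : Presents f T) : T ≤ halfSphere N ↔ HalfCommute (f ∘ coord) := by
  simp [halfSphere, hf.le_ofRelations_iff, @forall_comm (FreeAlg N), HalfCommute, sub_eq_zero]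

theorem le_twistedSphere_iff (hf : Presents f T) :
    T ≤ twistedSphere N ↔ PairwiseCommute (twist (f ∘ coord)) := by
  simp [twistedSphere, hf.le_ofRelations_iff, @forall_comm (FreeAlg N), pairwiseCommute_twist_iff,
    add_eq_zero_iff_eq_neg]

theorem le_twistedHalfSphere_iff (hf : Presents f T) :
    T ≤ twistedHalfSphere N ↔ HalfCommute (twist (f ∘ coord)) := by
  simp [twistedHalfSphere, hf.le_ofRelations_iff, @forall_comm (FreeAlg N), halfCommute_twist_iff,
    or_imp, forall_and, sub_eq_zero, add_eq_zero_iff_eq_neg]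

theorem le_untwistedMonomial_iff (hf : Presents f T) (E : Set Permutation) :
    T ≤ untwistedMonomial N E ↔ Commutation (f ∘ coord) (level E) := by
  rw [← forall_permRel_iff (sum_map_coord_sq f)]
  simp [untwistedMonomial, untwistedRel, hf.le_ofRelations_iff, @forall_comm (FreeAlg N), PermRel,
    Sigma.forall, sub_eq_zero, map_monomial]

theorem le_twistedMonomial_iff (hf : Presents f T) (E : Set Permutation) :
    T ≤ twistedMonomial N E ↔ Commutation (twist (f ∘ coord)) (level E) := by
  rw [← forall_permRel_iff (sum_twist_sq (sum_map_coord_sq f))]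
  simp [twistedMonomial, twistedRel, hf.le_ofRelations_iff, @forall_comm (FreeAlg N),
    Sigma.forall, permRel_twist_iff, sub_eq_zero, map_monomial]

theorem le_untwistedMain_iff (hf : Presents f T) (a : Fin 3) :
    T ≤ untwistedMain N a ↔ Commutation (f ∘ coord) a := by
  fin_cases a
  exacts [le_realSphere_iff hf, le_halfSphere_iff hf, iff_of_true le_freeSphere trivial]

theorem le_twistedMain_iff (hf : Presents f T) (b : Fin 3) :
    T ≤ twistedMain N b ↔ Commutation (twist (f ∘ coord)) b := by
  fin_cases b
  exacts [le_twistedSphere_iff hf, le_twistedHalfSphere_iff hf, iff_of_true le_freeSphere trivial]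

theorem le_vanishing_iff (hf : Presents f T) (d : ℕ) :
    T ≤ vanishing d S ↔ T ≤ S ∧ ∀ i : Fin (d + 1) → Fin N, Function.Injective i →
      word (f ∘ coord) (List.ofFn i) = 0 := by
  simp only [vanishing, le_inter_iff, hf.le_ofRelations_iff, ← map_monomial, Set.mem_ofPred_eq,
    forall_exists_index, and_imp, @forall_comm (FreeAlg N), forall_eq]

theorem le_vanishing_one_iff (hf : Presents f T) :
    T ≤ vanishing 1 S ↔ T ≤ S ∧ ∀ i j, i ≠ j → f (coord i) * f (coord j) = 0 := by
  rw [le_vanishing_iff hf]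
  refine and_congr_right fun _ => ⟨fun h i j hij => ?_, fun h i hi => ?_⟩
  · simpa using h ![i, j] (by simp [Function.Injective, Fin.forall_fin_two, hij, hij.symm])
  · simpa using h (i 0) (i 1) (hi.ne (by decide))

theorem le_vanishing_two_iff (hf : Presents f T) :
    T ≤ vanishing 2 S ↔ T ≤ S ∧ ∀ i j k, i ≠ j ∧ j ≠ k ∧ i ≠ k →
      f (coord i) * f (coord j) * f (coord k) = 0 := by
  rw [le_vanishing_iff hf]
  refine and_congr_right fun _ => ⟨fun h i j k hd => ?_, fun h i hi => ?_⟩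
  · obtain ⟨hij, hjk, hik⟩ := hd
    simpa [mul_assoc] using h ![i, j, k] (by
      simp [Function.Injective, Fin.forall_fin_succ, hij, hij.symm, hjk, hjk.symm, hik, hik.symm])
  · simpa [mul_assoc] using h (i 0) (i 1) (i 2)
      ⟨hi.ne (by decide), hi.ne (by decide), hi.ne (by decide)⟩

end Presents

section Vanishing

variable {N : ℕ} {A : Type*} [Ring A] [Algebra ℂ A] {x : Fin N → A}

theorem PairwiseCommute.pairwiseCommute_twist_iff (h : PairwiseCommute x) :
    PairwiseCommute (twist x) ↔ ∀ i j, i ≠ j → x i * x j = 0 := by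
  have : IsAddTorsionFree A := .of_isTorsionFree ℂ A
  rw [QSphere.pairwiseCommute_twist_iff]
  exact forall₂_congr fun i j => imp_congr_right fun _ => by rw [h j i, self_eq_neg]

theorem HalfCommute.halfCommute_twist_iff (h : HalfCommute x) :
    HalfCommute (twist x) ↔ ∀ i j k, i ≠ j ∧ j ≠ k ∧ i ≠ k → x i * x j * x k = 0 := by
  have : IsAddTorsionFree A := .of_isTorsionFree ℂ A
  rw [QSphere.halfCommute_twist_iff, and_iff_left fun i j k _ => h i j k]
  exact forall₃_congr fun i j k => imp_congr_right fun _ => by rw [h k j i, self_eq_neg]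

theorem pairwiseCommute_iff_of_twist (h : PairwiseCommute (twist x)) :
    PairwiseCommute x ↔ ∀ i j, i ≠ j → x i * x j = 0 := by
  refine ⟨fun hx => hx.pairwiseCommute_twist_iff.1 h, fun h0 i j => ?_⟩
  obtain rfl | hij := eq_or_ne i j
  exacts [rfl, by rw [h0 i j hij, h0 j i hij.symm]]

theorem halfCommute_iff_of_twist (h : HalfCommute (twist x)) :
    HalfCommute x ↔ ∀ i j k, i ≠ j ∧ j ≠ k ∧ i ≠ k → x i * x j * x k = 0 := by
  refine ⟨fun hx => hx.halfCommute_twist_iff.1 h, fun h0 i j k => ?_⟩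
  rw [QSphere.halfCommute_twist_iff] at h
  by_cases hd : i ≠ j ∧ j ≠ k ∧ i ≠ k
  · rw [h0 i j k hd, h0 k j i ⟨hd.2.1.symm, hd.1.symm, hd.2.2.symm⟩]
  · exact h.2 i j k hd

end Vanishing

section Spheres

variable {N : ℕ}

theorem nineMain_eq_inter (b a : Fin 3) :
    nineMain N b a = inter (untwistedMain N a) (twistedMain N b) := by
  refine eq_of_forall_le_iff fun T => ?_
  have hT := presents_mkₐ T
  have hreal := le_realSphere_iff hT
  have hhalf := le_halfSphere_iff hT
  have htw := le_twistedSphere_iff hT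
  have htwHalf := le_twistedHalfSphere_iff hT
  rw [le_inter_iff]
  fin_cases b <;> fin_cases a
  · exact (le_vanishing_one_iff hT).trans <| and_congr_right fun h =>
      (hreal.1 h).pairwiseCommute_twist_iff.symm.trans htw.symm
  · exact (le_vanishing_two_iff hT).trans <| and_comm.trans <| and_congr_left fun h =>
      (halfCommute_iff_of_twist (htw.1 h).halfCommute).symm.trans hhalf.symm
  · exact (and_iff_right le_freeSphere).symm
  · exact (le_vanishing_two_iff hT).trans <| and_congr_right fun h =>
      (hreal.1 h).halfCommute.halfCommute_twist_iff.symm.trans htwHalf.symm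
  · exact (le_vanishing_two_iff hT).trans <| and_congr_right fun h =>
      (hhalf.1 h).halfCommute_twist_iff.symm.trans htwHalf.symm
  · exact (and_iff_right le_freeSphere).symm
  all_goals exact (and_iff_left le_freeSphere).symm

theorem untwistedMonomial_eq_untwistedMain (N : ℕ) (E : Set Permutation) :
    untwistedMonomial N E = untwistedMain N (level E) :=
  eq_of_forall_le_iff fun T =>
    (le_untwistedMonomial_iff (presents_mkₐ T) E).trans
      (le_untwistedMain_iff (presents_mkₐ T) _).symm

theorem twistedMonomial_eq_twistedMain (N : ℕ) (E : Set Permutation) :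
    twistedMonomial N E = twistedMain N (level E) :=
  eq_of_forall_le_iff fun T =>
    (le_twistedMonomial_iff (presents_mkₐ T) E).trans (le_twistedMain_iff (presents_mkₐ T) _).symm

theorem polygonal_eq_nineMain (N : ℕ) (E F : Set Permutation) :
    polygonal N E F = nineMain N (level F) (level E) := by
  rw [polygonal, untwistedMonomial_eq_untwistedMain, twistedMonomial_eq_twistedMain,
    nineMain_eq_inter]

theorem untwistedMain_monotone (N : ℕ) : Monotone (untwistedMain N) := fun a b hab =>
  (le_untwistedMain_iff (presents_mkₐ _) b).2 <|
    ((le_untwistedMain_iff (presents_mkₐ _) a).1 le_rfl).mono hab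

theorem twistedMain_monotone (N : ℕ) : Monotone (twistedMain N) := fun a b hab =>
  (le_twistedMain_iff (presents_mkₐ _) b).2 <|
    ((le_twistedMain_iff (presents_mkₐ _) a).1 le_rfl).mono hab

theorem range_untwistedMonomial (N : ℕ) :
    Set.range (untwistedMonomial N) = {realSphere N, halfSphere N, freeSphere N} := by
  rw [funext (untwistedMonomial_eq_untwistedMain N)]
  exact (level_surjective.range_comp (untwistedMain N)).trans <|
    by simp only [untwistedMain, Matrix.range_cons, Matrix.range_empty, Set.union_empty,
      Set.insert_eq]

theorem range_twistedMonomial (N : ℕ) :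
    Set.range (twistedMonomial N) = {twistedSphere N, twistedHalfSphere N, freeSphere N} := by
  rw [funext (twistedMonomial_eq_twistedMain N)]
  exact (level_surjective.range_comp (twistedMain N)).trans <|
    by simp only [twistedMain, Matrix.range_cons, Matrix.range_empty, Set.union_empty,
      Set.insert_eq]

theorem polygonal_eq_setOf (N : ℕ) :
    {S | ∃ E F, S = polygonal N E F} = {S | ∃ b a, S = nineMain N b a} := by
  ext S
  simp only [Set.mem_ofPred_eq, polygonal_eq_nineMain]
  rw [exists_comm]
  simp only [level_surjective.exists]

end Spheres

section UnitsBelow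

variable {N n : ℕ} {A : Type*} [Ring A] {x : Fin N → A}

/-- The first `n` members of a family are units, and the other ones vanish. The larger `n`, the
fewer products of distinct members vanish, hence the fewer spheres contain the family. -/
structure UnitsBelow (x : Fin N → A) (n : ℕ) : Prop where
  isUnit (i : Fin N) : (i : ℕ) < n → IsUnit (x i)
  eq_zero (i : Fin N) : n ≤ i → x i = 0

variable [Nontrivial A]

theorem UnitsBelow.forall_mul_eq_zero_iff (hx : UnitsBelow x n) (hnN : n ≤ N) :
    (∀ i j, i ≠ j → x i * x j = 0) ↔ n ≤ 1 := by
  refine ⟨fun h => ?_, fun hn i j hij => ?_⟩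
  · by_contra! hn
    exact ((hx.isUnit ⟨0, by omega⟩ (by dsimp; omega)).mul
      (hx.isUnit ⟨1, by omega⟩ (by dsimp; omega))).ne_zero (h _ _ (by simp))
  · obtain hi | hj : n ≤ i ∨ n ≤ j := by omega
    exacts [by rw [hx.eq_zero i hi, zero_mul], by rw [hx.eq_zero j hj, mul_zero]]

theorem UnitsBelow.forall_mul_mul_eq_zero_iff (hx : UnitsBelow x n) (hnN : n ≤ N) :
    (∀ i j k, i ≠ j ∧ j ≠ k ∧ i ≠ k → x i * x j * x k = 0) ↔ n ≤ 2 := by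
  refine ⟨fun h => ?_, fun hn i j k hd => ?_⟩
  · by_contra! hn
    exact (((hx.isUnit ⟨0, by omega⟩ (by dsimp; omega)).mul
      (hx.isUnit ⟨1, by omega⟩ (by dsimp; omega))).mul
      (hx.isUnit ⟨2, by omega⟩ hn)).ne_zero (h _ _ _ (by simp))
  · obtain hi | hj | hk : n ≤ i ∨ n ≤ j ∨ n ≤ k := by omega
    exacts [by simp [hx.eq_zero i hi], by simp [hx.eq_zero j hj], by simp [hx.eq_zero k hk]]

variable [Algebra ℂ A]

theorem UnitsBelow.commutation_twist_iff (hx : UnitsBelow x n) (hnN : n ≤ N) (hn : n ≤ 3)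
    (h : PairwiseCommute x) (b : Fin 3) : Commutation (twist x) b ↔ n ≤ b + 1 := by
  fin_cases b
  exacts [h.pairwiseCommute_twist_iff.trans (hx.forall_mul_eq_zero_iff hnN),
    h.halfCommute.halfCommute_twist_iff.trans (hx.forall_mul_mul_eq_zero_iff hnN),
    iff_of_true trivial hn]

theorem UnitsBelow.commutation_iff_of_twist (hx : UnitsBelow x n) (hnN : n ≤ N) (hn : n ≤ 3)
    (h : PairwiseCommute (twist x)) (a : Fin 3) : Commutation x a ↔ n ≤ a + 1 := by
  fin_cases a
  exacts [(pairwiseCommute_iff_of_twist h).trans (hx.forall_mul_eq_zero_iff hnN),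
    (halfCommute_iff_of_twist h.halfCommute).trans (hx.forall_mul_mul_eq_zero_iff hnN),
    iff_of_true trivial hn]

end UnitsBelow

section Truncation

variable {N n : ℕ} {B : Type} [CStarAlgebra B] {v : ℕ → B}

/-- The solution of the relations of the free sphere formed by `n` symmetries, scaled by `1 / √n`
and followed by zeros. -/
noncomputable def truncate (N n : ℕ) (v : ℕ → B) (i : Fin N) : B :=
  if (i : ℕ) < n then (√n)⁻¹ • v i else 0

theorem star_truncate (hv : ∀ i, IsSelfAdjoint (v i)) (i : Fin N) :
    star (truncate N n v i) = truncate N n v i := by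
  unfold truncate
  split_ifs
  exacts [by rw [star_smul, star_trivial, (hv i).star_eq], star_zero B]

theorem sum_truncate_sq (hv : ∀ i, v i * v i = 1) (hn : n ≠ 0) (hnN : n ≤ N) :
    ∑ i, truncate N n v i * truncate N n v i = 1 := by
  have hsq (i : Fin N) : truncate N n v i * truncate N n v i =
      if (i : ℕ) < n then (n : ℝ)⁻¹ • (1 : B) else 0 := by
    unfold truncate
    split_ifs
    · rw [smul_mul_smul_comm, hv, ← mul_inv, Real.mul_self_sqrt n.cast_nonneg]
    · exact mul_zero 0
  rw [Finset.sum_congr rfl fun i _ => hsq i, ← Finset.sum_filter, Finset.sum_const,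
    Fin.card_filter_val_lt, min_eq_right hnN, ← Nat.cast_smul_eq_nsmul ℝ, smul_smul,
    mul_inv_cancel₀ (Nat.cast_ne_zero.2 hn), one_smul]

theorem unitsBelow_truncate (hv : ∀ i, v i * v i = 1) : UnitsBelow (truncate N n v) n where
  isUnit i hi := by
    rw [truncate, if_pos hi]
    have hn : (√n)⁻¹ ≠ 0 := by
      have : 0 < n := by omega
      positivity
    exact (Units.mk (v i) (v i) (hv i) (hv i)).isUnit.smul (Units.mk0 _ hn)
  eq_zero i hi := if_neg hi.not_gt

theorem pairwiseCommute_twist_truncate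
    (hv : ∀ i < n, ∀ j < n, i ≠ j → v i * v j = -(v j * v i)) :
    PairwiseCommute (twist (truncate N n v)) := by
  refine pairwiseCommute_twist_iff.2 fun i j hij => ?_
  unfold truncate
  split_ifs with hi hj
  · rw [smul_mul_smul_comm, smul_mul_smul_comm, hv i hi j hj (Fin.val_injective.ne hij), smul_neg]
  all_goals simp

theorem exists_presents_comp_coord_eq {x : Fin N → B} (hs : ∀ i, star (x i) = x i)
    (hx : ∑ i, x i * x i = 1) :
    ∃ (T : Subspace N) (f : FreeAlg N →ₐ[ℂ] B), Presents f T ∧ f ∘ coord = x :=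
  ⟨_, _, presents_ofHom (lift x hs hx), funext (lift_coord x hs hx)⟩

theorem exists_le_twistedMain_iff (hN : 3 ≤ N) (b : Fin 3) :
    ∃ T : Subspace N, (∀ a, T ≤ untwistedMain N a) ∧ ∀ b', T ≤ twistedMain N b' ↔ b ≤ b' := by
  have hsq (_ : ℕ) : (1 : ℂ) * 1 = 1 := mul_one 1
  obtain ⟨T, f, hf, hfx⟩ := exists_presents_comp_coord_eq (N := N)
    (star_truncate fun _ => IsSelfAdjoint.one ℂ)
    (sum_truncate_sq hsq b.val.succ_ne_zero (by omega))
  have hcomm : PairwiseCommute (f ∘ coord) := hfx ▸ fun _ _ => mul_comm _ _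
  have hunits : UnitsBelow (f ∘ coord) (b + 1) := hfx ▸ unitsBelow_truncate hsq
  exact ⟨T, fun a => (le_untwistedMain_iff hf a).2 (Commutation.mono (a := 0) hcomm a.zero_le),
    fun b' => (le_twistedMain_iff hf b').trans <|
      (hunits.commutation_twist_iff (by omega) (by omega) hcomm b').trans (by omega)⟩

end Truncation

section Pauli

open scoped Matrix.Norms.L2Operator

/-- The Pauli matrices. Indices above `2` repeat the third one. -/
noncomputable def pauli : ℕ → Matrix (Fin 2) (Fin 2) ℂ
  | 0 => !![0, 1; 1, 0]
  | 1 => !![0, -Complex.I; Complex.I, 0]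
  | _ => !![1, 0; 0, -1]

theorem isSelfAdjoint_pauli (i : ℕ) : IsSelfAdjoint (pauli i) := by
  rcases i with _ | _ | i <;> ext p q <;> fin_cases p <;> fin_cases q <;>
    simp [pauli, Matrix.star_apply]

theorem pauli_mul_self (i : ℕ) : pauli i * pauli i = 1 := by
  rcases i with _ | _ | i <;> simp [pauli, Matrix.one_fin_two]

theorem pauli_mul_pauli {i j : ℕ} (hi : i < 3) (hj : j < 3) (hij : i ≠ j) :
    pauli i * pauli j = -(pauli j * pauli i) := by
  interval_cases i <;> interval_cases j <;> first | exact absurd rfl hij | simp [pauli]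

theorem exists_le_untwistedMain_iff {N : ℕ} (hN : 3 ≤ N) (a : Fin 3) :
    ∃ T : Subspace N, (∀ b, T ≤ twistedMain N b) ∧ ∀ a', T ≤ untwistedMain N a' ↔ a ≤ a' := by
  obtain ⟨T, f, hf, hfx⟩ := exists_presents_comp_coord_eq (N := N)
    (star_truncate isSelfAdjoint_pauli)
    (sum_truncate_sq pauli_mul_self a.val.succ_ne_zero (by omega))
  have hcomm : PairwiseCommute (twist (f ∘ coord)) := hfx ▸ pairwiseCommute_twist_truncate
    fun i hi j hj => pauli_mul_pauli (by omega) (by omega)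
  have hunits : UnitsBelow (f ∘ coord) (a + 1) := hfx ▸ unitsBelow_truncate pauli_mul_self
  exact ⟨T, fun b => (le_twistedMain_iff hf b).2 (Commutation.mono (a := 0) hcomm b.zero_le),
    fun a' => (le_untwistedMain_iff hf a').trans <|
      (hunits.commutation_iff_of_twist (by omega) (by omega) hcomm a').trans (by omega)⟩

end Pauli

theorem le_and_le_of_nineMain_le {N : ℕ} (hN : 3 ≤ N) {b a b' a' : Fin 3}
    (h : nineMain N b a ≤ nineMain N b' a') : b ≤ b' ∧ a ≤ a' := by
  have key (T : Subspace N) : T ≤ untwistedMain N a ∧ T ≤ twistedMain N b →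
      T ≤ untwistedMain N a' ∧ T ≤ twistedMain N b' := by
    simpa only [nineMain_eq_inter, le_inter_iff] using fun hT => le_trans hT h
  obtain ⟨S, hS, hS'⟩ := exists_le_twistedMain_iff hN b
  obtain ⟨T, hT, hT'⟩ := exists_le_untwistedMain_iff hN a
  exact ⟨(hS' b').1 (key S ⟨hS a, (hS' b).2 le_rfl⟩).2,
    (hT' a').1 (key T ⟨(hT' a).2 le_rfl, hT b⟩).1⟩

theorem nineMain_injective {N : ℕ} (hN : 3 ≤ N) {b a b' a' : Fin 3}
    (h : nineMain N b a = nineMain N b' a') : b = b' ∧ a = a' :=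
  have h₁ := le_and_le_of_nineMain_le hN h.le
  have h₂ := le_and_le_of_nineMain_le hN h.ge
  ⟨h₁.1.antisymm h₂.1, h₁.2.antisymm h₂.2⟩

end QSphere

theorem theorem8p6 (N : ℕ) :
    -- the untwisted monomial spheres
    (QSphere.realSphere N ≤ QSphere.halfSphere N ∧
      QSphere.halfSphere N ≤ QSphere.freeSphere N ∧
      Set.range (QSphere.untwistedMonomial N) =
        {QSphere.realSphere N, QSphere.halfSphere N, QSphere.freeSphere N}) ∧
    -- the twisted monomial spheres
    (QSphere.twistedSphere N ≤ QSphere.twistedHalfSphere N ∧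
      QSphere.twistedHalfSphere N ≤ QSphere.freeSphere N ∧
      Set.range (QSphere.twistedMonomial N) =
        {QSphere.twistedSphere N, QSphere.twistedHalfSphere N, QSphere.freeSphere N}) ∧
    -- the polygonal spheres
    ({S | ∃ E F : Set QSphere.Permutation, S = QSphere.polygonal N E F} =
        {S | ∃ b a : Fin 3, S = QSphere.nineMain N b a} ∧
      (∀ b a : Fin 3, QSphere.nineMain N b a =
        QSphere.inter (QSphere.untwistedMain N a) (QSphere.twistedMain N b)) ∧
      (3 ≤ N → ∀ b a b' a' : Fin 3,
        QSphere.nineMain N b a = QSphere.nineMain N b' a' → b = b' ∧ a = a')) :=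
  ⟨⟨QSphere.untwistedMain_monotone N (Fin.zero_le 1), QSphere.le_freeSphere,
      QSphere.range_untwistedMonomial N⟩,
    ⟨QSphere.twistedMain_monotone N (Fin.zero_le 1), QSphere.le_freeSphere,
      QSphere.range_twistedMonomial N⟩,
    QSphere.polygonal_eq_setOf N, QSphere.nineMain_eq_inter,
    fun hN _ _ _ _ => QSphere.nineMain_injective hN⟩
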